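/- For a probability measure $\mu$ on $\mathbb{R}$ let $G_\mu(z)=\int \frac{\mu(dx)}{z-x}$, $F_\mu(z)=1/G_\mu(z)$ and $\eta_\mu(z)=1-zF_\mu(1/z)$. For a probability measure $\mu$ on $[0,\infty)$ and $0<t\le 1$, the multiplicative Boolean convolution power $\mu^{\cup\!\!\!\!\times\, t}$ is the probability measure on $[0,\infty)$ determined by $$\frac{\eta_{\mu^{\cup\!\!\!\!\times\, t}}(z)}{z}=\Big(\frac{\eta_\mu(z)}{z}\Big)^t,\qquad z\in(-\infty,0).$$ For $p>0$, the law $\nu^{p}$ is the push-forward of $\nu$ by $x\mapsto x^p$. The principal branch of $\log$ is used, $\log(w-i0):=\lim_{\varepsilon\downarrow0}\log(w-i\varepsilon)$, and $\mathbb{C}^+$ is the open upper half-plane. **Theorem.** Let $\mu$ be a probability measure on $[0,\infty)$. Assume that there is an open interval $I\subset(0,\infty)$ with $1\in I$ such that the limit $F_\mu(x):=\lim_{y\downarrow 0}F_\mu(x+iy)\in\mathbb{C}^+\cup\mathbb{R}$ exists for every $x\in I$, and such that the map $x\mapsto F_\mu(x)$ on $I$ is continuous at $1$. Assume moreover that $F_\mu(1)\in\mathbb{C}^+\cup(1,\infty)$.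 Then $\log(1-F_\mu(1)-i0)=\beta-i\gamma$ for some $\beta\in\mathbb{R}$ and $\gamma\in(0,\pi]$. On every compact set $K\subset(0,\infty)$, the law $(\mu^{\cup\!\!\!\!\times\, t})^{1/t}$ is, for all sufficiently small $t>0$, absolutely continuous with respect to Lebesgue measure, with a density satisfying $$\frac{d(\mu^{\cup\!\!\!\!\times\, t})^{1/t}}{dx}\;\longrightarrow\;\frac{\gamma}{\pi x\,[(\log x-\beta)^2+\gamma^2]}\qquad\text{as } t\downarrow 0,\ \text{uniformly on } K$$ (for a suitable version of the density that does not depend on $K$). In particular, $(\mu^{\cup\!\!\!\!\times\, t})^{1/t}$ converges weakly, as $t\downarrow0$, to the law of $e^{C_{\beta,\gamma}}$, where $C_{\beta,\gamma}$ has the Cauchy distribution $\frac{\gamma}{\pi}\frac{dx}{(x-\beta)^2+\gamma^2}$. -/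

import Mathlib

open MeasureTheory ProbabilityTheory Filter Set
open scoped Topology NNReal

noncomputable section

/-- The Cauchy transform `G_μ(z) = ∫ 1 / (z - x) μ(dx)`. -/
def cauchyTransform (μ : Measure ℝ) (z : ℂ) : ℂ :=
  ∫ x : ℝ, (z - (x : ℂ))⁻¹ ∂μ

/-- The reciprocal Cauchy transform (`F`-transform) `F_μ(z) = 1 / G_μ(z)`. -/
def fTransform (μ : Measure ℝ) (z : ℂ) : ℂ :=
  (cauchyTransform μ z)⁻¹

/-- The `η`-transform `η_μ(z) = 1 - z F_μ(1 / z)`. -/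
def etaTransform (μ : Measure ℝ) (z : ℂ) : ℂ :=
  1 - z * fTransform μ z⁻¹

/-- `ν` is a probability measure on `[0, ∞)` with
`η_ν(z) / z = (η_μ(z) / z) ^ t` for all `z ∈ (-∞, 0)`.
(If `μ` lives on `[0, ∞)`, then `η_μ(z) / z` is a nonnegative real for `z < 0`, so the power is the
ordinary real power.) -/
def IsMulBooleanPower (μ : ProbabilityMeasure ℝ) (t : ℝ) (ν : ProbabilityMeasure ℝ) : Prop :=
  (ν : Measure ℝ) (Iio 0) = 0 ∧
    ∀ z : ℝ, z < 0 →
      etaTransform (ν : Measure ℝ) (z : ℂ) / (z : ℂ) =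
        (etaTransform (μ : Measure ℝ) (z : ℂ) / (z : ℂ)) ^ (t : ℂ)

open Classical in
/-- The multiplicative Boolean convolution power of `μ` with exponent `t`: the probability measure
on `[0, ∞)` that satisfies `IsMulBooleanPower μ t`. It is unique, and it exists
for `0 < t ≤ 1` and every probability measure `μ` on `[0, ∞)`; where it does not exist,
the value is the point mass at `0`. -/
def mulBooleanPower (μ : ProbabilityMeasure ℝ) (t : ℝ) : ProbabilityMeasure ℝ :=
  if h : ∃ ν : ProbabilityMeasure ℝ, IsMulBooleanPower μ t ν then h.choose
  else ⟨Measure.dirac 0, inferInstance⟩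

/-- The push-forward of a law (on `[0, ∞)`) by the map `x ↦ x ^ p`. -/
def powLaw (μ : ProbabilityMeasure ℝ) (p : ℝ) : ProbabilityMeasure ℝ :=
  μ.map (f := fun x : ℝ => x ^ p) (by fun_prop)

/-- The law of `exp C`, where `C` has the Cauchy distribution with location `β` and scale `γ`. -/
def logCauchy (β : ℝ) (γ : ℝ≥0) : ProbabilityMeasure ℝ :=
  ProbabilityMeasure.map ⟨cauchyMeasure β γ, inferInstance⟩ (f := Real.exp) (by fun_prop)

/-- The boundary value `F_μ(x) = F_μ(x + i0) = lim_{y ↓ 0} F_μ(x + i y)`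
(only used at points where the limit exists). -/
def fBoundary (μ : Measure ℝ) (x : ℝ) : ℂ :=
  limUnder (𝓝[>] (0 : ℝ)) fun y : ℝ => fTransform μ ((x : ℂ) + (y : ℂ) * Complex.I)

/-- There is an open interval `I ⊆ (0, ∞)` containing `1` on which the boundary value
`F_μ(x + i0) ∈ ℂ⁺ ∪ ℝ` exists at every point, and `x ↦ F_μ(x + i0)` is continuous at `1`. -/
def FBoundaryNearOne (μ : Measure ℝ) : Prop :=
  ∃ I : Set ℝ, IsOpen I ∧ I.OrdConnected ∧ I ⊆ Ioi 0 ∧ (1 : ℝ) ∈ I ∧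
    (∀ x ∈ I, ∃ w : ℂ, 0 ≤ w.im ∧
      Tendsto (fun y : ℝ => fTransform μ ((x : ℂ) + (y : ℂ) * Complex.I)) (𝓝[>] 0) (𝓝 w)) ∧
    ContinuousWithinAt (fBoundary μ) I 1

/-- On `s`, the measure `ν` is absolutely continuous with respect to Lebesgue measure
with density `f`. -/
def HasDensityOn (ν : Measure ℝ) (f : ℝ → ℝ) (s : Set ℝ) : Prop :=
  Measurable f ∧ (∀ x ∈ s, 0 ≤ f x) ∧
    ν.restrict s = (volume.restrict s).withDensity fun x => ENNReal.ofReal (f x)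

end

/-!
The proof works with the self-energy `K_μ(z) = z - F_μ(z)`. Since `η_μ(z) / z = K_μ(1 / z)`, the
Boolean power `ν` with exponent `t` is characterized by `K_ν = K_μ ^ t` on `(-∞, 0)`. For `μ` on
`[0, ∞)` other than `δ₀`, the function `K_μ` is holomorphic off `[0, ∞)` and avoids `(-∞, 0]`
(`selfEnergy_mem_slitPlane`), so that `K_μ ^ t` is holomorphic there and the relation extends to
`G_ν(z) = 1 / (z - K_μ(z) ^ t)` on the upper half-plane
(`IsMulBooleanPower.cauchyTransform_eq`).

Such a `ν` exists for small `t`, which is all that matters (`exists_isMulBooleanPower`). Indeed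
`Φ(z) = 1 / (z - K_μ(z) ^ t)` has nonpositive imaginary part and `z Φ(z) → 1` at infinity, as `K_μ`
grows at most quadratically; functions of this kind are Cauchy transforms of probability measures
(`exists_cauchyTransform_eq`). This instance of Nevanlinna's theorem is obtained from Cauchy's
formula on horizontal lines, tightness, and Prokhorov's theorem.

Near `x = 1`, the boundary value of `G_ν` at `x` is `1 / (x - exp (t ℓ(x)))`, where
`ℓ(x) = log (K_μ(x + i0))` is continuous at `1` with `ℓ(1) = log (1 - F_μ(1) - i0) = β - iγ`. As
boundary values are only known pointwise, the passage to a density uses the differentiation theorem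
for measures: a finite boundary value at every point excludes a singular part, and Fatou's theorem
identifies the density as `-Im G_ν(x + i0) / π`
(`restrict_eq_withDensity_of_tendsto_cauchyTransform`).

The law of the `1 / t`-th power then has density `t s ^ (t - 1) · (-Im G_ν(x + i0) / π)` with
`x = s ^ t`. Since `x = 1 + t log s + o(t)` and `exp (t ℓ(x)) = 1 + t (β - iγ) + o(t)`, this tends
to `-Im (1 / (log s - β + iγ)) / (π s)`, locally uniformly in `s` (`tendsto_powLaw_density`), which
is the log-Cauchy density. Its total mass is `1`, so that no mass escapes and weak convergence
follows (`tendsto_of_tendstoUniformlyOn_density`).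
-/

noncomputable section

/-! ### Cauchy transforms off the support -/

/-- The complex plane cut along `[0, ∞)`. -/
def cutPlane : Set ℂ := {z | z.re < 0 ∨ z.im ≠ 0}

theorem cutPlane_eq_preimage : cutPlane = Neg.neg ⁻¹' Complex.slitPlane := by
  ext z
  simp [cutPlane, Complex.mem_slitPlane_iff]

theorem isOpen_cutPlane : IsOpen cutPlane := by
  rw [cutPlane_eq_preimage]
  exact Complex.isOpen_slitPlane.preimage continuous_neg

theorem isPreconnected_cutPlane : IsPreconnected cutPlane := by
  have h : cutPlane = Neg.neg '' Complex.slitPlane := by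
    rw [cutPlane_eq_preimage, Set.image_neg_eq_neg]; rfl
  rw [h]
  have hc := Complex.starConvex_one_slitPlane.isPathConnected Complex.one_mem_slitPlane
  exact hc.isConnected.isPreconnected.image _ continuous_neg.continuousOn

theorem mem_cutPlane_of_im_pos {z : ℂ} (hz : 0 < z.im) : z ∈ cutPlane := Or.inr hz.ne'

theorem im_le_norm_sub (z : ℂ) (x : ℝ) : |z.im| ≤ ‖z - x‖ := by
  simpa using Complex.abs_im_le_norm (z - x)

theorem ae_im_le_norm_sub (ν : Measure ℝ) {z : ℂ} (_ : 0 < z.im) :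
    ∀ᵐ x : ℝ ∂ν, z.im ≤ ‖z - x‖ :=
  Eventually.of_forall fun x => (le_abs_self _).trans (im_le_norm_sub z x)

theorem ae_nonneg_of_measure_Iio {ν : Measure ℝ} (hν : ν (Iio 0) = 0) : ∀ᵐ x ∂ν, 0 ≤ x := by
  have : {x : ℝ | ¬ 0 ≤ x} = Iio 0 := by ext; simp
  rw [ae_iff, this, hν]

theorem exists_le_norm_sub_of_mem_cutPlane {ν : Measure ℝ} (hν : ν (Iio 0) = 0) {z : ℂ}
    (hz : z ∈ cutPlane) : ∃ r > 0, ∀ᵐ x : ℝ ∂ν, r ≤ ‖z - x‖ := by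
  by_cases h : z.im = 0
  · have hre : z.re < 0 := hz.resolve_right (by simpa using h)
    refine ⟨-z.re, by linarith, ?_⟩
    filter_upwards [ae_nonneg_of_measure_Iio hν] with x hx
    calc -z.re ≤ |(z - x).re| := by
          simp only [Complex.sub_re, Complex.ofReal_re]
          rw [abs_of_neg (by linarith)]; linarith
      _ ≤ _ := Complex.abs_re_le_norm _
  · exact ⟨|z.im|, abs_pos.2 h, Eventually.of_forall (im_le_norm_sub z)⟩

section
variable {ν : Measure ℝ} [IsFiniteMeasure ν] {z : ℂ} {r : ℝ}

theorem integrable_inv_sub (hr : 0 < r) (h : ∀ᵐ x : ℝ ∂ν, r ≤ ‖z - x‖) :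
    Integrable (fun x : ℝ => (z - (x : ℂ))⁻¹) ν := by
  refine Integrable.of_bound (by fun_prop) r⁻¹ ?_
  filter_upwards [h] with x hx
  rw [norm_inv]
  gcongr

theorem integrable_inv_normSq_sub (hr : 0 < r) (h : ∀ᵐ x : ℝ ∂ν, r ≤ ‖z - x‖) :
    Integrable (fun x : ℝ => (Complex.normSq (z - x))⁻¹) ν := by
  refine Integrable.of_bound (by fun_prop) (r ^ 2)⁻¹ ?_
  filter_upwards [h] with x hx
  rw [norm_inv, Real.norm_of_nonneg (Complex.normSq_nonneg _), Complex.normSq_eq_norm_sq]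
  gcongr

theorem differentiableAt_cauchyTransform (hr : 0 < r) (h : ∀ᵐ x : ℝ ∂ν, r ≤ ‖z - x‖) :
    DifferentiableAt ℂ (cauchyTransform ν) z := by
  have key : ∀ᵐ x : ℝ ∂ν, ∀ w ∈ Metric.ball z (r / 2), r / 2 ≤ ‖w - x‖ := by
    filter_upwards [h] with x hx w hw
    have h1 : ‖z - x‖ ≤ ‖z - w‖ + ‖w - x‖ := norm_sub_le_norm_sub_add_norm_sub z w x
    rw [mem_ball_iff_norm'] at hw
    linarith
  have := hasDerivAt_integral_of_dominated_loc_of_deriv_le (μ := ν) (𝕜 := ℂ)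
    (F := fun (w : ℂ) (x : ℝ) => (w - (x : ℂ))⁻¹) (x₀ := z) (bound := fun _ => ((r / 2) ^ 2)⁻¹)
    (F' := fun (w : ℂ) (x : ℝ) => -1 / (w - (x : ℂ)) ^ 2)
    (Metric.ball_mem_nhds z (half_pos hr)) (Eventually.of_forall fun w => by fun_prop)
    (integrable_inv_sub hr h)
    (Measurable.aestronglyMeasurable (by fun_prop)) ?_ (integrable_const _) ?_
  · exact this.2.differentiableAt
  · filter_upwards [key] with x hx w hw
    rw [norm_div, norm_neg, norm_one, norm_pow, one_div]
    have := hx w hw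
    gcongr
  · filter_upwards [key] with x hx w hw
    have h0 : w - (x : ℂ) ≠ 0 := by
      intro h0
      have := hx w hw
      rw [h0, norm_zero] at this
      linarith
    exact ((hasDerivAt_id w).sub_const (x : ℂ)).inv h0

theorem cauchyTransform_im (hr : 0 < r) (h : ∀ᵐ x : ℝ ∂ν, r ≤ ‖z - x‖) :
    (cauchyTransform ν z).im = -z.im * ∫ x : ℝ, (Complex.normSq (z - x))⁻¹ ∂ν := by
  have h1 := integral_im (𝕜 := ℂ) (integrable_inv_sub hr h)
  simp only [RCLike.im_to_complex] at h1
  rw [cauchyTransform, ← h1, ← integral_const_mul]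
  refine integral_congr_ae (Eventually.of_forall fun x => ?_)
  simp [Complex.inv_im, div_eq_mul_inv]

end

theorem differentiableOn_cauchyTransform_upper (ν : Measure ℝ) [IsFiniteMeasure ν] :
    DifferentiableOn ℂ (cauchyTransform ν) {z | 0 < z.im} := fun _ hz =>
  (differentiableAt_cauchyTransform hz (ae_im_le_norm_sub ν hz)).differentiableWithinAt

theorem differentiableOn_cauchyTransform_cutPlane {ν : Measure ℝ} [IsFiniteMeasure ν]
    (hν : ν (Iio 0) = 0) : DifferentiableOn ℂ (cauchyTransform ν) cutPlane := fun _ hz =>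
  have ⟨_, hr, h⟩ := exists_le_norm_sub_of_mem_cutPlane hν hz
  (differentiableAt_cauchyTransform hr h).differentiableWithinAt

/-! ### The self-energy `z - F_μ(z)` -/

/-- The self-energy `K_μ(z) = z - F_μ(z)`, which the Boolean power raises to the power `t`. -/
def selfEnergy (μ : Measure ℝ) (z : ℂ) : ℂ := z - fTransform μ z

theorem etaTransform_div_eq_selfEnergy (μ : Measure ℝ) {z : ℂ} (hz : z ≠ 0) :
    etaTransform μ z / z = selfEnergy μ z⁻¹ := by
  rw [etaTransform, selfEnergy]
  field_simp

theorem cauchyTransform_ne_zero_of_im_pos {ν : Measure ℝ} [IsProbabilityMeasure ν] {z : ℂ}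
    (hz : 0 < z.im) : cauchyTransform ν z ≠ 0 := by
  intro h0
  have h := ae_im_le_norm_sub ν hz
  have h1 := cauchyTransform_im hz h
  rw [h0, Complex.zero_im, eq_comm, mul_eq_zero] at h1
  have h2 : 0 < ∫ x : ℝ, (Complex.normSq (z - x))⁻¹ ∂ν := by
    rw [integral_pos_iff_support_of_nonneg_ae
      (Eventually.of_forall fun x => inv_nonneg.2 (Complex.normSq_nonneg _))
      (integrable_inv_normSq_sub hz h)]
    have : Function.support (fun x : ℝ => (Complex.normSq (z - x))⁻¹) = univ := by
      refine eq_univ_of_forall fun x => inv_ne_zero ?_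
      rw [Ne, Complex.normSq_eq_zero]
      intro h3
      have := congrArg Complex.im h3
      simp at this
      linarith
    rw [this]; simp
  rcases h1 with h1 | h1 <;> linarith

/-- For `z` off the cut, the numbers `1 / (z - x)` with `x ≥ 0` lie in one open half-plane, so that
no integral of them against a weight `g ≥ 0` vanishes unless `g = 0` almost everywhere. -/
theorem integral_mul_inv_sub_ne_zero {ν : Measure ℝ} (hν : ν (Iio 0) = 0)
    {z : ℂ} (hz : z ∈ cutPlane) {g : ℝ → ℝ} (hg : ∀ᵐ x ∂ν, 0 ≤ g x)
    (hpos : ν (Function.support g) ≠ 0)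
    (hint : Integrable (fun x : ℝ => (g x : ℂ) * (z - x)⁻¹) ν) :
    ∫ x : ℝ, (g x : ℂ) * (z - x)⁻¹ ∂ν ≠ 0 := by
  intro h0
  -- A real-linear functional that is positive on the values `1 / (z - x)`.
  obtain ⟨a, b, hab⟩ : ∃ a b : ℝ, ∀ x : ℝ, 0 ≤ x →
      0 < a * ((z - x)⁻¹).re + b * ((z - x)⁻¹).im := by
    by_cases h : z.im = 0
    · have hre : z.re < 0 := hz.resolve_right (by simpa using h)
      refine ⟨-1, 0, fun x hx => ?_⟩
      have h1 : 0 < Complex.normSq (z - x) := by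
        rw [Complex.normSq_pos]
        intro h2
        have := congrArg Complex.re h2
        simp at this
        linarith
      have : ((z - x)⁻¹).re < 0 := by
        rw [Complex.inv_re]
        exact div_neg_of_neg_of_pos (by simp; linarith) h1
      linarith
    · refine ⟨0, -z.im, fun x hx => ?_⟩
      have h1 : 0 < Complex.normSq (z - x) := by
        rw [Complex.normSq_pos]
        intro h2
        have := congrArg Complex.im h2
        simp at this
        exact h this
      rw [Complex.inv_im]
      have : 0 < z.im ^ 2 / Complex.normSq (z - x) := div_pos (by positivity) h1
      simp only [Complex.sub_im, Complex.ofReal_im, sub_zero]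
      calc 0 < _ := this
        _ = _ := by ring
  have hre := integral_re (𝕜 := ℂ) hint
  have him := integral_im (𝕜 := ℂ) hint
  simp only [RCLike.re_to_complex, RCLike.im_to_complex, Complex.re_ofReal_mul,
    Complex.im_ofReal_mul] at hre him
  have hI1 := hint.re
  have hI2 := hint.im
  simp only [RCLike.re_to_complex, RCLike.im_to_complex, Complex.re_ofReal_mul,
    Complex.im_ofReal_mul] at hI1 hI2
  have hsum : ∫ x : ℝ, (a * (g x * ((z - x)⁻¹).re) + b * (g x * ((z - x)⁻¹).im)) ∂ν = 0 := by
    rw [integral_add (hI1.const_mul a) (hI2.const_mul b), integral_const_mul, integral_const_mul,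
      hre, him, h0]
    simp
  have hnn : ∀ᵐ x : ℝ ∂ν, 0 ≤ a * (g x * ((z - x)⁻¹).re) + b * (g x * ((z - x)⁻¹).im) := by
    filter_upwards [hg, ae_nonneg_of_measure_Iio hν] with x h1 h2
    have := mul_nonneg h1 (hab x h2).le
    linarith
  rw [integral_eq_zero_iff_of_nonneg_ae hnn ((hI1.const_mul a).add (hI2.const_mul b))] at hsum
  apply hpos
  rw [← compl_mem_ae_iff]
  filter_upwards [hsum, ae_nonneg_of_measure_Iio hν] with x h1 h2
  have h3 : g x * (a * ((z - x)⁻¹).re + b * ((z - x)⁻¹).im) = 0 := by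
    simp only [Pi.zero_apply] at h1
    linarith
  simpa using (mul_eq_zero.1 h3).resolve_right (hab x h2).ne'

theorem cauchyTransform_ne_zero_of_mem_cutPlane {ν : Measure ℝ} [IsProbabilityMeasure ν]
    (hν : ν (Iio 0) = 0) {z : ℂ} (hz : z ∈ cutPlane) : cauchyTransform ν z ≠ 0 := by
  obtain ⟨r, hr, h⟩ := exists_le_norm_sub_of_mem_cutPlane hν hz
  have := integral_mul_inv_sub_ne_zero hν hz (g := fun _ => 1) (by simp)
    (by simp [Function.support_const])
    (by simpa using integrable_inv_sub hr h)
  simpa [cauchyTransform] using this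

theorem differentiableOn_selfEnergy {μ : Measure ℝ} [IsProbabilityMeasure μ]
    (hμ : μ (Iio 0) = 0) : DifferentiableOn ℂ (selfEnergy μ) cutPlane := by
  unfold selfEnergy fTransform
  exact differentiableOn_id.sub ((differentiableOn_cauchyTransform_cutPlane hμ).inv
    fun z hz => cauchyTransform_ne_zero_of_mem_cutPlane hμ hz)

/-- Off the cut, `K_μ` avoids `(-∞, 0]`: the equation `K_μ(z) = -c` with `c ≥ 0` would read
`∫ (x + c) / (z - x) μ(dx) = 0`. -/
theorem selfEnergy_mem_slitPlane {μ : Measure ℝ} [IsProbabilityMeasure μ]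
    (hμ : μ (Iio 0) = 0) (hμ0 : μ (Ioi 0) ≠ 0) {z : ℂ} (hz : z ∈ cutPlane) :
    selfEnergy μ z ∈ Complex.slitPlane := by
  obtain ⟨r, hr, h⟩ := exists_le_norm_sub_of_mem_cutPlane hμ hz
  have hG := cauchyTransform_ne_zero_of_mem_cutPlane hμ hz
  by_contra hK
  rw [Complex.mem_slitPlane_iff, not_or, not_lt, not_not] at hK
  obtain ⟨c, hc, hKc⟩ : ∃ c : ℝ, 0 ≤ c ∧ selfEnergy μ z = -(c : ℂ) :=
    ⟨-(selfEnergy μ z).re, by linarith [hK.1], by apply Complex.ext <;> simp [hK.2]⟩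
  have hGz : (z + c) * cauchyTransform μ z = 1 := by
    rw [selfEnergy, fTransform] at hKc
    have : z + c = (cauchyTransform μ z)⁻¹ := by linear_combination hKc
    rw [this, inv_mul_cancel₀ hG]
  have hI := integrable_inv_sub hr h
  have heq : (fun x : ℝ => ((x + c : ℝ) : ℂ) * (z - x)⁻¹) =ᵐ[μ]
      fun x : ℝ => (z + c) * (z - x)⁻¹ - 1 := by
    filter_upwards [h] with x hx
    have : z - (x : ℂ) ≠ 0 := by
      intro h0
      rw [h0, norm_zero] at hx
      linarith
    push_cast
    field_simp
    ring
  refine integral_mul_inv_sub_ne_zero hμ hz (g := fun x => x + c) ?_ ?_ ?_ ?_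
  · filter_upwards [ae_nonneg_of_measure_Iio hμ] with x hx using by linarith
  · refine fun h0 => hμ0 (measure_mono_null (fun x hx => ?_) h0)
    simp only [mem_Ioi] at hx
    simp only [Function.mem_support]
    linarith
  · exact ((hI.const_mul _).sub (integrable_const _)).congr heq.symm
  · rw [integral_congr_ae heq, integral_sub (hI.const_mul _) (integrable_const _),
      integral_const_mul]
    change (z + c) * cauchyTransform μ z - _ = 0
    rw [hGz]
    simp

/-- `Im F_μ(z) ≥ Im z`, by the Cauchy–Schwarz inequality. -/
theorem selfEnergy_im_nonpos {μ : Measure ℝ} [IsProbabilityMeasure μ] {z : ℂ} (hz : 0 < z.im) :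
    (selfEnergy μ z).im ≤ 0 := by
  have h := ae_im_le_norm_sub μ hz
  have hG := cauchyTransform_ne_zero_of_im_pos (ν := μ) hz
  have hI := integrable_inv_normSq_sub hz h
  have hn := (integrable_inv_sub hz h).norm
  set m := ∫ x : ℝ, ‖(z - (x : ℂ))⁻¹‖ ∂μ with hm
  have hsq : ∀ x : ℝ, ‖(z - (x : ℂ))⁻¹‖ ^ 2 = (Complex.normSq (z - x))⁻¹ := fun x => by
    rw [norm_inv, inv_pow, Complex.normSq_eq_norm_sq]
  have hCS : m ^ 2 ≤ ∫ x : ℝ, (Complex.normSq (z - x))⁻¹ ∂μ := by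
    have h0 : 0 ≤ ∫ x : ℝ, (‖(z - (x : ℂ))⁻¹‖ - m) ^ 2 ∂μ :=
      integral_nonneg fun x => sq_nonneg _
    have h1 : (fun x : ℝ => (‖(z - (x : ℂ))⁻¹‖ - m) ^ 2) =
        fun x : ℝ => (Complex.normSq (z - x))⁻¹ - 2 * m * ‖(z - (x : ℂ))⁻¹‖ + m ^ 2 := by
      ext x
      rw [← hsq]; ring
    rw [h1, integral_add (f := fun x : ℝ => (Complex.normSq (z - x))⁻¹ - 2 * m * ‖(z - (x : ℂ))⁻¹‖)
      (hI.sub (hn.const_mul _)) (integrable_const _), integral_sub hI (hn.const_mul _),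
      integral_const_mul, ← hm] at h0
    simp only [integral_const, probReal_univ, smul_eq_mul, one_mul] at h0
    nlinarith
  have hGm : ‖cauchyTransform μ z‖ ^ 2 ≤ m ^ 2 := by
    gcongr
    exact norm_integral_le_integral_norm _
  have hpos : 0 < Complex.normSq (cauchyTransform μ z) := Complex.normSq_pos.2 hG
  rw [selfEnergy, fTransform, Complex.sub_im, Complex.inv_im, cauchyTransform_im hz h, sub_nonpos,
    le_div_iff₀ hpos, Complex.normSq_eq_norm_sq]
  nlinarith

/-- `|G_μ(z)| ≥ Im z ∫ |z - x|⁻² μ(dx)` and `|z - x|² ≤ 2 (1 + |z|²) (1 + x²)` bound `1 / |G_μ(z)|`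
by a multiple of `1 + |z|²`. -/
theorem exists_norm_selfEnergy_le (μ : Measure ℝ) [IsProbabilityMeasure μ] {ε : ℝ} (hε : 0 < ε) :
    ∃ C : ℝ, 1 ≤ C ∧ ∀ z : ℂ, ε ≤ z.im → ‖selfEnergy μ z‖ ≤ C * (1 + ‖z‖ ^ 2) := by
  have hI0 : Integrable (fun x : ℝ => (1 + x ^ 2)⁻¹) μ := by
    refine Integrable.of_bound (by fun_prop) 1 (Eventually.of_forall fun x => ?_)
    rw [Real.norm_of_nonneg (by positivity)]
    exact inv_le_one_of_one_le₀ (by nlinarith)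
  set c := ∫ x : ℝ, (1 + x ^ 2)⁻¹ ∂μ with hc
  have hcpos : 0 < c := by
    rw [hc, integral_pos_iff_support_of_nonneg_ae
      (Eventually.of_forall fun x => by positivity) hI0]
    have : Function.support (fun x : ℝ => (1 + x ^ 2)⁻¹) = univ :=
      eq_univ_of_forall fun x => by
        have : (0 : ℝ) < 1 + x ^ 2 := by positivity
        exact (inv_pos.2 this).ne'
    rw [this]; simp
  refine ⟨1 + 2 / (c * ε), by have : 0 < 2 / (c * ε) := by positivity
                              linarith, fun z hz => ?_⟩
  have hz0 : 0 < z.im := hε.trans_le hz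
  have h := ae_im_le_norm_sub μ hz0
  have hI := integrable_inv_normSq_sub hz0 h
  have h1 : (2 * (1 + ‖z‖ ^ 2))⁻¹ * c ≤ ∫ x : ℝ, (Complex.normSq (z - x))⁻¹ ∂μ := by
    rw [hc, ← integral_const_mul]
    refine integral_mono_ae (hI0.const_mul _) hI ?_
    filter_upwards [h] with x hx
    rw [← mul_inv, Complex.normSq_eq_norm_sq]
    have h3 : ‖z - x‖ ≤ ‖z‖ + |x| := by
      simpa using norm_sub_le z (x : ℂ)
    have h4 : 0 < ‖z - x‖ := hz0.trans_le hx
    have h5 : ‖z - x‖ ^ 2 ≤ (‖z‖ + |x|) ^ 2 := by gcongr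
    have h6 : |x| ^ 2 = x ^ 2 := sq_abs x
    gcongr
    nlinarith [sq_nonneg (‖z‖ - |x|), mul_nonneg (sq_nonneg ‖z‖) (sq_nonneg x)]
  have h2 : ε * ((2 * (1 + ‖z‖ ^ 2))⁻¹ * c) ≤ ‖cauchyTransform μ z‖ := by
    refine le_trans ?_ (Complex.abs_im_le_norm _)
    rw [cauchyTransform_im hz0 h, neg_mul, abs_neg, abs_of_nonneg (by
      have := integral_nonneg (μ := μ) (f := fun x : ℝ => (Complex.normSq (z - x))⁻¹)
        (fun x => inv_nonneg.2 (Complex.normSq_nonneg _))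
      positivity)]
    gcongr
  have h3 : ‖fTransform μ z‖ ≤ 2 / (c * ε) * (1 + ‖z‖ ^ 2) := by
    rw [fTransform, norm_inv]
    calc ‖cauchyTransform μ z‖⁻¹ ≤ (ε * ((2 * (1 + ‖z‖ ^ 2))⁻¹ * c))⁻¹ := by
          gcongr
      _ = _ := by field_simp
  calc ‖selfEnergy μ z‖ ≤ ‖z‖ + ‖fTransform μ z‖ := norm_sub_le _ _
    _ ≤ (1 + ‖z‖ ^ 2) + 2 / (c * ε) * (1 + ‖z‖ ^ 2) := by
        gcongr
        nlinarith [sq_nonneg (‖z‖ - 1)]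
    _ = _ := by ring

/-! ### Boundary values of the Cauchy transform and the density -/

/-- The Poisson integral `∫ y / ((x - s)² + y²) ν(ds)`, without the usual factor `1 / π`. -/
def poissonIntegral (ν : Measure ℝ) (x y : ℝ) : ENNReal :=
  ∫⁻ s, ENNReal.ofReal (y / ((x - s) ^ 2 + y ^ 2)) ∂ν

theorem poissonIntegral_eq_neg_im (ν : Measure ℝ) [IsFiniteMeasure ν] (x : ℝ) {y : ℝ}
    (hy : 0 < y) :
    poissonIntegral ν x y = ENNReal.ofReal (-(cauchyTransform ν (x + y * Complex.I)).im) := by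
  have hz : 0 < ((x : ℂ) + y * Complex.I).im := by simpa using hy
  have h := ae_im_le_norm_sub ν hz
  rw [cauchyTransform_im hz h, neg_mul, neg_neg, ← integral_const_mul,
    ofReal_integral_eq_lintegral_ofReal ((integrable_inv_normSq_sub hz h).const_mul _)
      (Eventually.of_forall fun s => mul_nonneg hz.le (inv_nonneg.2 (Complex.normSq_nonneg _)))]
  refine lintegral_congr fun s => ?_
  simp [Complex.normSq_apply, div_eq_mul_inv, pow_two]

theorem tendsto_one_add_sq_inv_atTop :
    Tendsto (fun u : ℝ => (1 + u ^ 2)⁻¹) atTop (𝓝 0) :=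
  tendsto_inv_atTop_zero.comp
    (tendsto_atTop_add_const_left _ _ (tendsto_pow_atTop two_ne_zero))

theorem lintegral_Ioi_poisson_layer {a : ℝ} (ha : 0 ≤ a) :
    ∫⁻ u in Ioi a, ENNReal.ofReal (2 * u / (1 + u ^ 2) ^ 2) = ENNReal.ofReal (1 + a ^ 2)⁻¹ := by
  have hd : ∀ u ∈ Ici a,
      HasDerivAt (fun u : ℝ => -(1 + u ^ 2)⁻¹) (2 * u / (1 + u ^ 2) ^ 2) u := fun u _ => by
    have h1 : (1 + u ^ 2 : ℝ) ≠ 0 := by positivity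
    have := (((hasDerivAt_id u).pow 2).const_add 1).inv (by simpa using h1)
    refine this.neg.congr_deriv ?_
    simp
    ring
  have hnn : ∀ u ∈ Ioi a, 0 ≤ 2 * u / (1 + u ^ 2) ^ 2 := fun u hu => by
    have : 0 ≤ u := ha.trans (le_of_lt hu)
    positivity
  have hlim : Tendsto (fun u : ℝ => -(1 + u ^ 2)⁻¹) atTop (𝓝 0) := by
    simpa using tendsto_one_add_sq_inv_atTop.neg
  rw [← ofReal_integral_eq_lintegral_ofReal (integrableOn_Ioi_deriv_of_nonneg' hd hnn hlim)
    ((ae_restrict_iff' measurableSet_Ioi).2 (Eventually.of_forall hnn)),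
    integral_Ioi_of_hasDerivAt_of_nonneg' hd hnn hlim]
  simp

theorem lintegral_Ioi_poisson_weight :
    ∫⁻ u in Ioi (0 : ℝ), ENNReal.ofReal (4 * u ^ 2 / (1 + u ^ 2) ^ 2) =
      ENNReal.ofReal Real.pi := by
  have hd : ∀ u ∈ Ici (0 : ℝ),
      HasDerivAt (fun u : ℝ => 2 * (Real.arctan u - u * (1 + u ^ 2)⁻¹))
        (4 * u ^ 2 / (1 + u ^ 2) ^ 2) u := fun u _ => by
    have h1 : (1 + u ^ 2 : ℝ) ≠ 0 := by positivity
    have h2 := (((hasDerivAt_id u).pow 2).const_add 1).inv (by simpa using h1)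
    have h3 := ((Real.hasDerivAt_arctan u).sub ((hasDerivAt_id u).mul h2)).const_mul 2
    refine h3.congr_deriv ?_
    simp
    field_simp
    ring
  have hnn : ∀ u ∈ Ioi (0 : ℝ), 0 ≤ 4 * u ^ 2 / (1 + u ^ 2) ^ 2 := fun u _ => by positivity
  have hlim : Tendsto (fun u : ℝ => 2 * (Real.arctan u - u * (1 + u ^ 2)⁻¹)) atTop
      (𝓝 Real.pi) := by
    have h1 : Tendsto (fun u : ℝ => u * (1 + u ^ 2)⁻¹) atTop (𝓝 0) := by
      refine squeeze_zero' (g := fun u : ℝ => u⁻¹) ?_ ?_ tendsto_inv_atTop_zero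
      · filter_upwards [eventually_ge_atTop 0] with u hu using by positivity
      · filter_upwards [eventually_gt_atTop 0] with u hu
        rw [← div_eq_mul_inv, div_le_iff₀ (by positivity)]
        field_simp
        nlinarith
    have h2 := ((Real.tendsto_arctan_atTop.mono_right nhdsWithin_le_nhds).sub h1).const_mul 2
    convert h2 using 2
    ring
  rw [← ofReal_integral_eq_lintegral_ofReal (integrableOn_Ioi_deriv_of_nonneg' hd hnn hlim)
    ((ae_restrict_iff' measurableSet_Ioi).2 (Eventually.of_forall hnn)),
    integral_Ioi_of_hasDerivAt_of_nonneg' hd hnn hlim]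
  simp

/-- Layer-cake formula: the Poisson integral is an average of the difference quotients
`ν(B(x, r)) / |B(x, r)|` over `r = y u`, with the weight `4u² / (1 + u²)²`. -/
theorem poissonIntegral_eq_lintegral_ratio (ν : Measure ℝ) [IsFiniteMeasure ν] (x : ℝ) {y : ℝ}
    (hy : 0 < y) :
    poissonIntegral ν x y = ∫⁻ u in Ioi (0 : ℝ),
      ν (Metric.closedBall x (y * u)) / volume (Metric.closedBall x (y * u)) *
        ENNReal.ofReal (4 * u ^ 2 / (1 + u ^ 2) ^ 2) := by
  set k : ℝ → ENNReal := fun u => ENNReal.ofReal (2 * u / (1 + u ^ 2) ^ 2) with hk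
  have hkm : Measurable k := by fun_prop
  set S : Set (ℝ × ℝ) := {p : ℝ × ℝ | |x - p.1| / y ≤ p.2} with hS
  have hset : MeasurableSet S := measurableSet_le (by fun_prop) (by fun_prop)
  have h1 : ∀ s : ℝ, ENNReal.ofReal (y / ((x - s) ^ 2 + y ^ 2)) =
      ENNReal.ofReal y⁻¹ * ∫⁻ u in Ioi (0 : ℝ), S.indicator (fun p => k p.2) (s, u) := fun s => by
    have h2 : (fun u => S.indicator (fun p => k p.2) (s, u)) =
        (Ici (|x - s| / y)).indicator k := by
      ext u
      simp [indicator_apply, hS]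
    have ha : 0 ≤ |x - s| / y := by positivity
    have h3 : (Ici (|x - s| / y) ∩ Ioi 0 : Set ℝ) =ᵐ[volume] Ioi (|x - s| / y) := by
      have := (Ioi_ae_eq_Ici (μ := volume) (a := |x - s| / y)).symm.inter
        (ae_eq_refl (Ioi (0 : ℝ)))
      rwa [inter_eq_left.2 (Ioi_subset_Ioi ha)] at this
    rw [h2, setLIntegral_indicator measurableSet_Ici, setLIntegral_congr h3,
      lintegral_Ioi_poisson_layer ha, ← ENNReal.ofReal_mul (by positivity)]
    congr 1
    rw [div_pow, sq_abs]
    field_simp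
    ring
  rw [poissonIntegral]
  simp_rw [h1]
  rw [lintegral_const_mul _ (by
      exact ((hkm.comp measurable_snd).indicator hset).lintegral_prod_right'),
    lintegral_lintegral_swap (f := fun s u => S.indicator (fun p => k p.2) (s, u))
      ((hkm.comp measurable_snd).indicator hset).aemeasurable,
    ← lintegral_const_mul' _ _ ENNReal.ofReal_ne_top]
  refine setLIntegral_congr_fun measurableSet_Ioi fun u hu => ?_
  have hu0 : 0 < u := hu
  have h3 : (fun s => S.indicator (fun p => k p.2) (s, u)) =
      (Metric.closedBall x (y * u)).indicator fun _ => k u := by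
    ext s
    have : |x - s| / y ≤ u ↔ s ∈ Metric.closedBall x (y * u) := by
      rw [div_le_iff₀ hy, Metric.mem_closedBall', Real.dist_eq, mul_comm]
    classical
    simp only [indicator_apply, ← this]
    rfl
  have h4 : ENNReal.ofReal (4 * u ^ 2 / (1 + u ^ 2) ^ 2) =
      ENNReal.ofReal (2 * (y * u)) * (ENNReal.ofReal y⁻¹ * k u) := by
    rw [hk, ← ENNReal.ofReal_mul (by positivity), ← ENNReal.ofReal_mul (by positivity)]
    congr 1
    field_simp
    ring
  simp only [h3]
  rw [lintegral_indicator_const Metric.isClosed_closedBall.measurableSet, Real.volume_closedBall,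
    h4, ← mul_assoc (ν _ / _), ENNReal.div_mul_cancel (by simpa using mul_pos hy hu0)
      ENNReal.ofReal_ne_top]
  ring

/-- Fatou's theorem: where the symmetric derivative of `ν` exists, the Poisson integral converges
to `π` times that derivative. -/
theorem tendsto_poissonIntegral_of_tendsto_ratio (ν : Measure ℝ) [IsFiniteMeasure ν] {x : ℝ}
    {L : ENNReal} (hL : L ≠ ⊤)
    (h : Tendsto (fun r => ν (Metric.closedBall x r) / volume (Metric.closedBall x r))
      (𝓝[>] 0) (𝓝 L)) :
    Tendsto (poissonIntegral ν x) (𝓝[>] 0) (𝓝 (L * ENNReal.ofReal Real.pi)) := by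
  -- The difference quotients are bounded: near `0` by convergence, elsewhere as `ν` is finite.
  obtain ⟨M, hM, hbd⟩ : ∃ M : ENNReal, M ≠ ⊤ ∧ ∀ r > 0,
      ν (Metric.closedBall x r) / volume (Metric.closedBall x r) ≤ M := by
    have h1 := h.eventually (gt_mem_nhds (ENNReal.lt_add_right hL one_ne_zero))
    obtain ⟨δ, hδ, h2⟩ := mem_nhdsGT_iff_exists_Ioo_subset.1 h1
    have hδ0 : (0 : ℝ) < δ := hδ
    refine ⟨max (L + 1) (ν univ / ENNReal.ofReal (2 * δ)), ?_, fun r hr => ?_⟩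
    · rw [Ne, max_eq_top, not_or]
      refine ⟨by simpa using hL, (ENNReal.div_lt_top (measure_ne_top _ _) ?_).ne⟩
      simpa using hδ0
    · rcases lt_or_ge r δ with hrδ | hrδ
      · exact (le_of_lt (h2 ⟨hr, hrδ⟩)).trans (le_max_left _ _)
      · refine le_trans ?_ (le_max_right _ _)
        rw [Real.volume_closedBall]
        gcongr
        exact subset_univ _
  have hlim : Tendsto (fun y => ∫⁻ u in Ioi (0 : ℝ),
      ν (Metric.closedBall x (y * u)) / volume (Metric.closedBall x (y * u)) *
        ENNReal.ofReal (4 * u ^ 2 / (1 + u ^ 2) ^ 2)) (𝓝[>] 0)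
      (𝓝 (∫⁻ u in Ioi (0 : ℝ), L * ENNReal.ofReal (4 * u ^ 2 / (1 + u ^ 2) ^ 2))) := by
    refine tendsto_lintegral_filter_of_dominated_convergence
      (fun u => M * ENNReal.ofReal (4 * u ^ 2 / (1 + u ^ 2) ^ 2)) ?_ ?_ ?_ ?_
    · filter_upwards [self_mem_nhdsWithin] with y hy
      have hy0 : (0 : ℝ) < y := hy
      refine Measurable.mul (Measurable.div ?_ ?_) (by fun_prop)
      · exact Monotone.measurable fun a b hab =>
          measure_mono (Metric.closedBall_subset_closedBall (by gcongr))
      · exact Monotone.measurable fun a b hab =>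
          measure_mono (Metric.closedBall_subset_closedBall (by gcongr))
    · filter_upwards [self_mem_nhdsWithin] with y hy
      filter_upwards [ae_restrict_mem measurableSet_Ioi] with u hu
      gcongr
      exact hbd _ (mul_pos hy hu)
    · rw [lintegral_const_mul' _ _ hM, lintegral_Ioi_poisson_weight]
      exact ENNReal.mul_ne_top hM ENNReal.ofReal_ne_top
    · filter_upwards [ae_restrict_mem measurableSet_Ioi] with u (hu : 0 < u)
      refine ENNReal.Tendsto.mul_const (h.comp ?_) (Or.inr ENNReal.ofReal_ne_top)
      refine tendsto_nhdsWithin_iff.2 ⟨?_, ?_⟩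
      · have : Tendsto (fun y : ℝ => y * u) (𝓝 0) (𝓝 (0 * u)) :=
          (continuous_id.mul continuous_const).tendsto 0
        rw [zero_mul] at this
        exact this.mono_left nhdsWithin_le_nhds
      · filter_upwards [self_mem_nhdsWithin] with y hy using mul_pos hy hu
  rw [lintegral_const_mul' _ _ hL, lintegral_Ioi_poisson_weight] at hlim
  refine hlim.congr' ?_
  filter_upwards [self_mem_nhdsWithin] with y hy
  exact (poissonIntegral_eq_lintegral_ratio ν x hy).symm

theorem ratio_le_poissonIntegral (ν : Measure ℝ) (x : ℝ) {r : ℝ} (hr : 0 < r) :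
    ν (Metric.closedBall x r) / volume (Metric.closedBall x r) ≤ poissonIntegral ν x r := by
  have hc : ENNReal.ofReal (2 * r)⁻¹ = (volume (Metric.closedBall x r))⁻¹ := by
    rw [Real.volume_closedBall, ENNReal.ofReal_inv_of_pos (by positivity)]
  rw [div_eq_mul_inv, mul_comm, ← hc,
    ← lintegral_indicator_const Metric.isClosed_closedBall.measurableSet]
  refine lintegral_mono fun s => ?_
  by_cases hs : s ∈ Metric.closedBall x r
  · rw [indicator_of_mem hs]
    refine ENNReal.ofReal_le_ofReal ?_
    rw [Metric.mem_closedBall', Real.dist_eq] at hs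
    have h1 : (x - s) ^ 2 ≤ r ^ 2 := by
      rw [← sq_abs]
      gcongr
    rw [inv_le_comm₀ (by positivity) (by positivity), inv_div, div_le_iff₀ hr]
    nlinarith
  · rw [indicator_of_notMem hs]
    exact zero_le

/-- If `G_ν` has a finite boundary value at every point of `J`, then `ν` has no singular part on
`J`: at almost every point with respect to the singular part, the symmetric derivative of `ν` is
infinite, and it bounds the Poisson integral from below. -/
theorem singularPart_eq_zero_of_tendsto_cauchyTransform {ν : Measure ℝ} [IsFiniteMeasure ν]
    {J : Set ℝ} {g : ℝ → ℂ}
    (h : ∀ x ∈ J, Tendsto (fun y : ℝ => cauchyTransform ν (x + y * Complex.I)) (𝓝[>] 0)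
      (𝓝 (g x))) :
    (ν.singularPart volume) J = 0 := by
  set σ := ν.singularPart volume with hσ
  have h0 : ∀ᵐ x ∂σ, (volume : Measure ℝ).rnDeriv σ x = 0 :=
    (Measure.rnDeriv_eq_zero volume σ).2 (Measure.mutuallySingular_singularPart ν volume).symm
  have hnull : ∀ᵐ x ∂σ, x ∉ J := by
    filter_upwards [h0, Besicovitch.ae_tendsto_rnDeriv (volume : Measure ℝ) σ] with x h1 h2 hx
    rw [h1] at h2
    have h3 : Tendsto (poissonIntegral ν x) (𝓝[>] 0) (𝓝 (ENNReal.ofReal (-(g x).im))) := by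
      have h4 : Tendsto (fun y : ℝ =>
          ENNReal.ofReal (-(cauchyTransform ν (x + y * Complex.I)).im)) (𝓝[>] 0)
          (𝓝 (ENNReal.ofReal (-(g x).im))) :=
        (ENNReal.continuous_ofReal.tendsto _).comp
          ((Complex.continuous_im.tendsto _).comp (h x hx)).neg
      refine h4.congr' ?_
      filter_upwards [self_mem_nhdsWithin] with y hy
      exact (poissonIntegral_eq_neg_im ν x hy).symm
    have h5 : Tendsto (fun r => σ (Metric.closedBall x r) / volume (Metric.closedBall x r))
        (𝓝[>] 0) (𝓝 ⊤) := by
      have := h2.inv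
      rw [ENNReal.inv_zero] at this
      refine this.congr' ?_
      filter_upwards [self_mem_nhdsWithin] with r hr
      have hr0 : (0 : ℝ) < r := hr
      rw [ENNReal.inv_div (Or.inl (measure_ne_top _ _))]
      right
      rw [Real.volume_closedBall]
      simpa using hr0
    have h6 := le_of_tendsto_of_tendsto h5 h3 (by
      filter_upwards [self_mem_nhdsWithin] with r hr
      refine le_trans ?_ (ratio_le_poissonIntegral ν x hr)
      gcongr
      exact Measure.singularPart_le _ _)
    exact ENNReal.ofReal_ne_top (top_le_iff.1 h6)
  rw [← compl_compl J, ← mem_ae_iff]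
  exact hnull

/-- Stieltjes inversion with pointwise boundary values: if `G_ν(x + i0)` exists and is finite at
every point `x` of `J`, then on `J` the measure `ν` has density `-Im G_ν(x + i0) / π`. -/
theorem restrict_eq_withDensity_of_tendsto_cauchyTransform {ν : Measure ℝ} [IsFiniteMeasure ν]
    {J : Set ℝ} (hJ : MeasurableSet J) {g : ℝ → ℂ}
    (h : ∀ x ∈ J, Tendsto (fun y : ℝ => cauchyTransform ν (x + y * Complex.I)) (𝓝[>] 0)
      (𝓝 (g x))) :
    ν.restrict J =
      (volume.restrict J).withDensity fun x => ENNReal.ofReal (-(g x).im / Real.pi) := by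
  have hdec := ν.haveLebesgueDecomposition_add volume
  have hd : (fun x => ν.rnDeriv volume x) =ᵐ[volume.restrict J]
      fun x => ENNReal.ofReal (-(g x).im / Real.pi) := by
    filter_upwards [ae_restrict_mem hJ,
      ae_restrict_of_ae (Besicovitch.ae_tendsto_rnDeriv ν (volume : Measure ℝ)),
      ae_restrict_of_ae (Measure.rnDeriv_lt_top ν volume)] with x hx h1 h2
    have h3 := tendsto_poissonIntegral_of_tendsto_ratio ν h2.ne h1
    have h4 : Tendsto (fun y : ℝ =>
        ENNReal.ofReal (-(cauchyTransform ν (x + y * Complex.I)).im)) (𝓝[>] 0)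
        (𝓝 (ENNReal.ofReal (-(g x).im))) :=
      (ENNReal.continuous_ofReal.tendsto _).comp
        ((Complex.continuous_im.tendsto _).comp (h x hx)).neg
    have h5 := tendsto_nhds_unique (h4.congr' (by
      filter_upwards [self_mem_nhdsWithin] with y hy
      exact (poissonIntegral_eq_neg_im ν x hy).symm)) h3
    rw [ENNReal.ofReal_div_of_pos Real.pi_pos, h5,
      ENNReal.mul_div_cancel_right (by simpa using Real.pi_pos) ENNReal.ofReal_ne_top]
  conv_lhs => rw [hdec]
  rw [Measure.restrict_add, Measure.restrict_eq_zero.2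
    (singularPart_eq_zero_of_tendsto_cauchyTransform h), zero_add, restrict_withDensity hJ,
    withDensity_congr_ae hd]

/-! ### Cauchy's integral formula in a half-plane -/

section HalfPlane

open Complex (I)

variable {f : ℂ → ℂ} {ε C R₀ : ℝ}

theorem add_mul_I_mem_halfPlane {ε : ℝ} (x : ℝ) : ε ≤ ((x : ℂ) + ε * I).im := by simp

theorem continuous_comp_horizontal (hf : DifferentiableOn ℂ f {z | ε ≤ z.im}) :
    Continuous fun x : ℝ => f (x + ε * I) :=
  hf.continuousOn.comp_continuous (by fun_prop) fun x => add_mul_I_mem_halfPlane x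

theorem integrable_horizontal (hf : DifferentiableOn ℂ f {z | ε ≤ z.im})
    (hC : ∀ z : ℂ, ε ≤ z.im → R₀ ≤ ‖z‖ → ‖f z‖ ≤ C / ‖z‖ ^ 2) :
    Integrable fun x : ℝ => f (x + ε * I) := by
  refine (continuous_comp_horizontal hf).locallyIntegrable.integrable_of_isBigO_cocompact
    (g := fun x : ℝ => (1 + x ^ 2)⁻¹) ?_ (integrable_inv_one_add_sq.integrableAtFilter _)
  refine Asymptotics.IsBigO.of_bound (2 * |C|) ?_
  filter_upwards [tendsto_norm_cocompact_atTop.eventually (eventually_ge_atTop (max R₀ 1))]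
    with x hx
  have h1 : ‖x‖ ≤ ‖(x : ℂ) + ε * I‖ := by
    simpa using Complex.abs_re_le_norm ((x : ℂ) + ε * I)
  have h2 : 1 ≤ ‖x‖ := (le_max_right _ _).trans hx
  refine (hC _ (add_mul_I_mem_halfPlane x) (((le_max_left _ _).trans hx).trans h1)).trans ?_
  have h3 : ‖x‖ ^ 2 ≤ ‖(x : ℂ) + ε * I‖ ^ 2 := by gcongr
  have h4 : 1 + x ^ 2 ≤ 2 * ‖(x : ℂ) + ε * I‖ ^ 2 := by
    rw [Real.norm_eq_abs, sq_abs] at h3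
    rw [Real.norm_eq_abs] at h2
    have : 1 ≤ x ^ 2 := by rw [← sq_abs]; nlinarith
    linarith
  have h5 : 0 < ‖(x : ℂ) + ε * I‖ ^ 2 := by nlinarith
  rw [Real.norm_of_nonneg (by positivity : 0 ≤ (1 + x ^ 2)⁻¹)]
  calc C / ‖(x : ℂ) + ε * I‖ ^ 2 ≤ |C| / ‖(x : ℂ) + ε * I‖ ^ 2 := by gcongr; exact le_abs_self C
    _ ≤ 2 * |C| * (1 + x ^ 2)⁻¹ := by
        rw [← div_eq_mul_inv, div_le_div_iff₀ h5 (by positivity)]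
        nlinarith [abs_nonneg C]

/-- A holomorphic function that decays like `1 / |z|²` in a half-plane has integral zero over the
boundary line. -/
theorem integral_horizontal_eq_zero (hε : 0 ≤ ε) (hf : DifferentiableOn ℂ f {z | ε ≤ z.im})
    (hC : ∀ z : ℂ, ε ≤ z.im → R₀ ≤ ‖z‖ → ‖f z‖ ≤ C / ‖z‖ ^ 2) :
    ∫ x : ℝ, f (x + ε * I) = 0 := by
  have hlim : Tendsto (fun R : ℝ => ∫ x in (-R)..R, f (x + ε * I)) atTop
      (𝓝 (∫ x : ℝ, f (x + ε * I))) :=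
    intervalIntegral_tendsto_integral (integrable_horizontal hf hC) tendsto_neg_atTop_atBot
      tendsto_id
  refine tendsto_nhds_unique hlim (squeeze_zero_norm' (a := fun R : ℝ => 4 * |C| / R) ?_
    (tendsto_const_nhds.div_atTop tendsto_id))
  -- Compare with the other three sides of the square above the segment `[-R, R]`.
  filter_upwards [eventually_ge_atTop (max R₀ 1)] with R hR
  have hR0 : R₀ ≤ R := (le_max_left _ _).trans hR
  have hR1 : 1 ≤ R := (le_max_right _ _).trans hR
  have hbd : ∀ z : ℂ, ε ≤ z.im → R ≤ ‖z‖ → ‖f z‖ ≤ |C| / R ^ 2 := fun z hz hz' => by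
    refine (hC z hz (hR0.trans hz')).trans ?_
    calc C / ‖z‖ ^ 2 ≤ |C| / ‖z‖ ^ 2 := by gcongr; exact le_abs_self C
      _ ≤ |C| / R ^ 2 := by gcongr
  have hrect := Complex.integral_boundary_rect_eq_zero_of_differentiableOn f ⟨-R, ε⟩ ⟨R, ε + R⟩
    (hf.mono fun z hz => by
      have := hz.2
      simp only [mem_preimage, uIcc_of_le (show ε ≤ ε + R by linarith)] at this
      exact this.1)
  have htop : ‖∫ x in (-R)..R, f (x + (ε + R : ℝ) * I)‖ ≤ |C| / R ^ 2 * |R - -R| := by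
    refine intervalIntegral.norm_integral_le_of_norm_le_const fun x _ =>
      hbd _ (by simp; linarith) ?_
    have := Complex.abs_im_le_norm ((x : ℂ) + (ε + R : ℝ) * I)
    simp only [Complex.add_im, Complex.ofReal_im, Complex.mul_im, Complex.ofReal_re, Complex.I_im,
      mul_one, Complex.I_re, mul_zero, add_zero, zero_add] at this
    linarith [le_abs_self (ε + R)]
  have hright : ‖∫ y in ε..(ε + R), f (R + y * I)‖ ≤ |C| / R ^ 2 * |ε + R - ε| := by
    refine intervalIntegral.norm_integral_le_of_norm_le_const fun y hy => hbd _ ?_ ?_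
    · rw [uIoc_of_le (by linarith)] at hy
      simpa using hy.1.le
    · simpa [abs_of_pos (zero_lt_one.trans_le hR1)] using Complex.abs_re_le_norm ((R : ℂ) + y * I)
  have hleft : ‖∫ y in ε..(ε + R), f ((-R : ℝ) + y * I)‖ ≤ |C| / R ^ 2 * |ε + R - ε| := by
    refine intervalIntegral.norm_integral_le_of_norm_le_const fun y hy => hbd _ ?_ ?_
    · rw [uIoc_of_le (by linarith)] at hy
      simpa using hy.1.le
    · simpa [abs_of_pos (zero_lt_one.trans_le hR1)] using
        Complex.abs_re_le_norm (((-R : ℝ) : ℂ) + y * I)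
  have heq : ∫ x in (-R)..R, f (x + ε * I) = (∫ x in (-R)..R, f (x + (ε + R : ℝ) * I)) -
      I • (∫ y in ε..(ε + R), f (R + y * I)) + I • (∫ y in ε..(ε + R), f ((-R : ℝ) + y * I)) := by
    simp only at hrect
    linear_combination hrect
  rw [heq]
  refine (norm_add_le _ _).trans ((add_le_add (norm_sub_le _ _) le_rfl).trans ?_)
  rw [norm_smul, norm_smul, Complex.norm_I, one_mul, one_mul]
  have h1 : |R - -R| = 2 * R := by rw [abs_of_nonneg] <;> linarith
  have h2 : |ε + R - ε| = R := by rw [abs_of_nonneg] <;> linarith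
  rw [h1] at htop
  rw [h2] at hright hleft
  calc _ ≤ |C| / R ^ 2 * (2 * R) + |C| / R ^ 2 * R + |C| / R ^ 2 * R := by gcongr
    _ = _ := by field_simp; ring

theorem norm_div_sub_le {c z a : ℂ} {A : ℝ} (hz : 1 ≤ ‖z‖) (ha : 2 * ‖a‖ ≤ ‖z‖)
    (hc : ‖c‖ ≤ A / ‖z‖) : ‖c / (z - a)‖ ≤ 2 * A / ‖z‖ ^ 2 := by
  have h1 : ‖z‖ / 2 ≤ ‖z - a‖ := by
    have := norm_sub_norm_le z a
    linarith
  have h0 : 0 < ‖z‖ / 2 := by linarith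
  rw [norm_div]
  have h2 : 0 ≤ A / ‖z‖ := (norm_nonneg c).trans hc
  calc ‖c‖ / ‖z - a‖ ≤ (A / ‖z‖) / (‖z‖ / 2) := by gcongr
    _ = _ := by field_simp

theorem integral_im_div_normSq {w : ℂ} (hw : 0 < w.im) :
    Integrable (fun x : ℝ => w.im * (Complex.normSq (x - w))⁻¹) ∧
    ∫ x : ℝ, w.im * (Complex.normSq (x - w))⁻¹ = Real.pi := by
  have h : ∀ x : ℝ, w.im * (Complex.normSq (x - w))⁻¹ =
      Real.pi * cauchyPDFReal w.re w.im.toNNReal x := fun x => by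
    rw [cauchyPDFReal_def, Real.coe_toNNReal _ hw.le, Complex.normSq_apply]
    simp only [Complex.sub_re, Complex.ofReal_re, Complex.sub_im, Complex.ofReal_im]
    rw [show (x - w.re) * (x - w.re) + (0 - w.im) * (0 - w.im) = (x - w.re) ^ 2 + w.im ^ 2 by ring]
    field_simp
  simp_rw [h]
  refine ⟨(integrable_cauchyPDFReal _).const_mul _, ?_⟩
  rw [integral_const_mul, integral_cauchyPDFReal_eq_one _ (by
    simpa using hw), mul_one]

/-- Cauchy's formula in the half-plane `Im z > ε`, combined with Cauchy's theorem for the reflected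
point: a function that decays like `1 / |z|` is the Cauchy transform of `-Im Φ / π` on the boundary
line. -/
theorem integral_im_mul_inv_sub_eq (hε : 0 ≤ ε) {Φ : ℂ → ℂ}
    (hΦ : DifferentiableOn ℂ Φ {z | ε ≤ z.im})
    (hC : ∀ z : ℂ, ε ≤ z.im → R₀ ≤ ‖z‖ → ‖Φ z‖ ≤ C / ‖z‖) {w : ℂ} (hw : 0 < w.im) :
    Integrable (fun x : ℝ => ((-(Φ (x + ε * I)).im / Real.pi : ℝ) : ℂ) * (w - x)⁻¹) ∧
    ∫ x : ℝ, ((-(Φ (x + ε * I)).im / Real.pi : ℝ) : ℂ) * (w - x)⁻¹ = Φ (w + ε * I) := by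
  set w₁ : ℂ := w + ε * I with hw₁
  set w₂ : ℂ := (starRingEnd ℂ) w + ε * I with hw₂
  have hw₁i : w₁.im = w.im + ε := by simp [hw₁]
  have hw₂i : w₂.im = -w.im + ε := by simp [hw₂]
  have hne₂ : ∀ z : ℂ, ε ≤ z.im → z - w₂ ≠ 0 := fun z hz h => by
    have := congrArg Complex.im h
    rw [Complex.sub_im, hw₂i, Complex.zero_im] at this
    linarith
  -- The reflected point lies outside the half-plane.
  set f₂ : ℂ → ℂ := fun z => Φ z / (z - w₂) with hf₂
  have hd₂ : DifferentiableOn ℂ f₂ {z | ε ≤ z.im} :=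
    hΦ.div (differentiableOn_id.sub_const _) fun z hz => hne₂ z hz
  have hb₂ : ∀ z : ℂ, ε ≤ z.im → max R₀ (max 1 (2 * ‖w₂‖)) ≤ ‖z‖ →
      ‖f₂ z‖ ≤ 2 * C / ‖z‖ ^ 2 := fun z hz hzn => by
    simp only [max_le_iff] at hzn
    exact norm_div_sub_le hzn.2.1 hzn.2.2 (hC z hz hzn.1)
  -- Subtracting a multiple of `1 / (z - w₂)` removes the pole at `w₁`.
  set g : ℂ → ℂ := fun z => Φ z - Φ w₁ * (w₁ - w₂) / (z - w₂) with hg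
  have hgd : DifferentiableOn ℂ g {z | ε ≤ z.im} :=
    hΦ.sub ((differentiableOn_const _).div (differentiableOn_id.sub_const _)
      fun z hz => hne₂ z hz)
  have hgw : g w₁ = 0 := by
    have := hne₂ w₁ (by rw [hw₁i]; linarith)
    simp only [hg]
    field_simp
    ring
  have hnhds : {z : ℂ | ε ≤ z.im} ∈ 𝓝 w₁ := by
    refine mem_of_superset ((isOpen_lt continuous_const Complex.continuous_im).mem_nhds
      (show ε < w₁.im by rw [hw₁i]; linarith)) fun z (hz : ε < z.im) => hz.le
  have hd₁ : DifferentiableOn ℂ (dslope g w₁) {z | ε ≤ z.im} :=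
    (Complex.differentiableOn_dslope hnhds).2 hgd
  have hds : ∀ z, z ≠ w₁ → dslope g w₁ z = g z / (z - w₁) := fun z hz => by
    rw [dslope_of_ne _ hz, slope_def_field, hgw, sub_zero]
  set A : ℝ := C + 2 * ‖Φ w₁ * (w₁ - w₂)‖ with hA
  have hb₁ : ∀ z : ℂ, ε ≤ z.im →
      max R₀ (max 1 (max (2 * ‖w₂‖) (2 * ‖w₁‖ + 1))) ≤ ‖z‖ →
      ‖dslope g w₁ z‖ ≤ 2 * A / ‖z‖ ^ 2 := fun z hz hzn => by
    simp only [max_le_iff] at hzn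
    obtain ⟨h1, h2, h3, h4⟩ := hzn
    rw [hds z (by rintro rfl; linarith [norm_nonneg w₁])]
    refine norm_div_sub_le h2 (by linarith) ?_
    have h5 : ‖z‖ / 2 ≤ ‖z - w₂‖ := by
      have := norm_sub_norm_le z w₂
      linarith
    have h0 : 0 < ‖z‖ / 2 := by linarith
    calc ‖g z‖ ≤ ‖Φ z‖ + ‖Φ w₁ * (w₁ - w₂) / (z - w₂)‖ := norm_sub_le _ _
      _ ≤ C / ‖z‖ + ‖Φ w₁ * (w₁ - w₂)‖ / (‖z‖ / 2) := by
          rw [norm_div]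
          gcongr
          exact hC z hz h1
      _ = _ := by rw [hA]; field_simp
  have hI₁ := integrable_horizontal hd₁ hb₁
  have hI₂ := integrable_horizontal hd₂ hb₂
  have hz₁ := integral_horizontal_eq_zero hε hd₁ hb₁
  have hz₂ := integral_horizontal_eq_zero hε hd₂ hb₂
  obtain ⟨hIP, hP⟩ := integral_im_div_normSq hw
  have hxw : ∀ x : ℝ, w - (x : ℂ) ≠ 0 := fun x h => by
    have := congrArg Complex.im h
    simp at this
    linarith
  have hww : w - (starRingEnd ℂ) w = 2 * I * w.im := by
    rw [Complex.sub_conj]; push_cast; ring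
  have hI₂c : Integrable fun x : ℝ => (starRingEnd ℂ) (f₂ (x + ε * I)) :=
    Complex.conjLIE.integrable_comp_iff.2 hI₂
  have hz₂c : ∫ x : ℝ, (starRingEnd ℂ) (f₂ (x + ε * I)) = 0 := by
    rw [integral_conj, hz₂, map_zero]
  have hkey : ∀ x : ℝ, ((-(Φ (x + ε * I)).im / Real.pi : ℝ) : ℂ) * (w - x)⁻¹ =
      (2 * I * Real.pi)⁻¹ * (dslope g w₁ (x + ε * I) - (starRingEnd ℂ) (f₂ (x + ε * I))) +
      Φ w₁ * (Real.pi : ℂ)⁻¹ * ((w.im * (Complex.normSq (x - w))⁻¹ : ℝ) : ℂ) := fun x => by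
    have hpi : (Real.pi : ℂ) ≠ 0 := by exact_mod_cast Real.pi_ne_zero
    have e₁ : (x : ℂ) + ε * I - w₁ = -(w - x) := by rw [hw₁]; ring
    have e₂ : (x : ℂ) + ε * I - w₂ = -(starRingEnd ℂ) (w - x) := by
      rw [hw₂, map_sub, Complex.conj_ofReal]; ring
    have e₃ : w₁ - w₂ = 2 * I * w.im := by rw [← hww]; ring
    have e₄ : ((Complex.normSq (x - w) : ℝ) : ℂ) = (w - x) * (starRingEnd ℂ) (w - x) := by
      rw [← Complex.normSq_neg, neg_sub, Complex.mul_conj]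
    have hq : (starRingEnd ℂ) (w - x) ≠ 0 := (map_ne_zero _).2 (hxw x)
    have hq' := hxw x
    have hp := Complex.sub_conj (Φ (x + ε * I))
    rw [hds _ (by
      intro h
      rw [h, sub_self, eq_comm, neg_eq_zero] at e₁
      exact hq' e₁)]
    simp only [hf₂, hg, map_div₀, e₁, e₂, e₃, map_neg, Complex.conj_conj]
    push_cast
    rw [e₄]
    push_cast at hp
    generalize (starRingEnd ℂ) (w - x) = q at *
    generalize w - (x : ℂ) = r at *
    have hp' : (starRingEnd ℂ) (Φ (x + ε * I)) = Φ (x + ε * I) - 2 * (Φ (x + ε * I)).im * I := by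
      linear_combination -hp
    rw [hp']
    field_simp
    ring
  simp_rw [hkey]
  have hIs : Integrable fun x : ℝ =>
      (2 * I * Real.pi)⁻¹ * (dslope g w₁ (x + ε * I) - (starRingEnd ℂ) (f₂ (x + ε * I))) :=
    (hI₁.sub hI₂c).const_mul _
  have hIt : Integrable fun x : ℝ =>
      Φ w₁ * (Real.pi : ℂ)⁻¹ * ((w.im * (Complex.normSq (x - w))⁻¹ : ℝ) : ℂ) :=
    hIP.ofReal.const_mul _
  refine ⟨hIs.add hIt, ?_⟩
  rw [integral_add hIs hIt, integral_const_mul, integral_const_mul, integral_sub hI₁ hI₂c, hz₁,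
    hz₂c, integral_complex_ofReal, hP]
  have : (Real.pi : ℂ) ≠ 0 := by exact_mod_cast Real.pi_ne_zero
  field_simp
  simp

end HalfPlane

/-! ### Functions that are Cauchy transforms of probability measures -/

section Nevanlinna

open Complex (I)

variable {Φ : ℂ → ℂ}

theorem exists_bound_of_tendsto {ε η : ℝ} (hη : 0 < η)
    (h1 : Tendsto (fun z => z * Φ z) (Bornology.cobounded ℂ ⊓ 𝓟 {z | ε ≤ z.im}) (𝓝 1)) :
    ∃ R : ℝ, 1 ≤ R ∧ ∀ z : ℂ, ε ≤ z.im → R ≤ ‖z‖ → ‖z * Φ z - 1‖ ≤ η := by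
  have h2 := (tendsto_iff_norm_sub_tendsto_zero.1 h1).eventually (ge_mem_nhds hη)
  rw [eventually_inf_principal, ← comap_norm_atTop, eventually_comap] at h2
  obtain ⟨R, hR⟩ := eventually_atTop.1 h2
  exact ⟨max R 1, le_max_right _ _, fun z hz hzR =>
    hR ‖z‖ ((le_max_left _ _).trans hzR) z rfl hz⟩

/-- A holomorphic function on the upper half-plane with `Im Φ ≤ 0` and `z Φ(z) → 1` at infinity
becomes, when shifted into the half-plane, the Cauchy transform of a probability measure with
density `-Im Φ(x + iε) / π`. -/
theorem exists_cauchyTransform_eq_shift {ε : ℝ} (hε : 0 < ε)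
    (hΦ : DifferentiableOn ℂ Φ {z | 0 < z.im}) (him : ∀ z : ℂ, 0 < z.im → (Φ z).im ≤ 0)
    (h1 : Tendsto (fun z => z * Φ z) (Bornology.cobounded ℂ ⊓ 𝓟 {z | ε ≤ z.im}) (𝓝 1)) :
    ∃ ν : ProbabilityMeasure ℝ, ∀ w : ℂ, 0 < w.im →
      cauchyTransform (ν : Measure ℝ) w = Φ (w + ε * I) := by
  have hΦε : DifferentiableOn ℂ Φ {z | ε ≤ z.im} := hΦ.mono fun z hz => hε.trans_le hz
  obtain ⟨R, hR1, hR⟩ := exists_bound_of_tendsto one_pos h1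
  have hC : ∀ z : ℂ, ε ≤ z.im → R ≤ ‖z‖ → ‖Φ z‖ ≤ 2 / ‖z‖ := fun z hz hzR => by
    have h2 := norm_le_norm_sub_add (z * Φ z) 1
    have h3 := hR z hz hzR
    rw [norm_one] at h2
    rw [norm_mul] at h2
    rw [le_div_iff₀ (by linarith)]
    linarith
  set h : ℝ → ℝ := fun x => -(Φ (x + ε * I)).im / Real.pi with hh
  have hcont : Continuous h :=
    ((Complex.continuous_im.comp (continuous_comp_horizontal hΦε)).neg).div_const _
  have hnn : ∀ x, 0 ≤ h x := fun x =>
    div_nonneg (by linarith [him _ (hε.trans_le (add_mul_I_mem_halfPlane x))]) Real.pi_pos.le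
  have hrep := fun (w : ℂ) (hw : 0 < w.im) => integral_im_mul_inv_sub_eq hε.le hΦε hC hw
  set ν : Measure ℝ := volume.withDensity fun x => ENNReal.ofReal (h x) with hν
  -- The total mass is the limit of `n · (-Im Φ(i n + i ε))`.
  have hmass : ν univ = 1 := by
    have hn : ∀ n : ℕ, ∫⁻ x, ENNReal.ofReal (h x * ((n : ℝ) ^ 2 / ((n : ℝ) ^ 2 + x ^ 2))) =
        ENNReal.ofReal (-(n * (Φ (n * I + ε * I)).im)) := fun n => by
      rcases Nat.eq_zero_or_pos n with rfl | hn0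
      · simp
      have hn0 : (0 : ℝ) < n := by exact_mod_cast hn0
      obtain ⟨hi, hi2⟩ := hrep (n * I) (by simpa using hn0)
      have heq : ∀ x : ℝ, h x * ((n : ℝ) ^ 2 / ((n : ℝ) ^ 2 + x ^ 2)) =
          -n * (((h x : ℝ) : ℂ) * ((n : ℂ) * I - x)⁻¹).im := fun x => by
        rw [Complex.im_ofReal_mul, Complex.inv_im, Complex.normSq_apply]
        simp
        field_simp
        ring
      have hi3 : Integrable fun x : ℝ => h x * ((n : ℝ) ^ 2 / ((n : ℝ) ^ 2 + x ^ 2)) := by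
        simp_rw [heq]
        exact hi.im.const_mul _
      rw [← ofReal_integral_eq_lintegral_ofReal hi3
        (Eventually.of_forall fun x => mul_nonneg (hnn x) (by positivity))]
      congr 1
      simp_rw [heq]
      have := integral_im hi
      simp only [RCLike.im_to_complex] at this
      rw [integral_const_mul, this, hi2]
      ring
    have hlim : Tendsto (fun n : ℕ =>
        ∫⁻ x, ENNReal.ofReal (h x * ((n : ℝ) ^ 2 / ((n : ℝ) ^ 2 + x ^ 2)))) atTop
        (𝓝 (∫⁻ x, ENNReal.ofReal (h x))) := by
      refine lintegral_tendsto_of_tendsto_of_monotone (fun n => ?_) ?_ ?_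
      · exact (by fun_prop : Measurable fun x : ℝ =>
          h x * ((n : ℝ) ^ 2 / ((n : ℝ) ^ 2 + x ^ 2))).ennreal_ofReal.aemeasurable
      · refine Eventually.of_forall fun x m n hmn => ENNReal.ofReal_le_ofReal ?_
        refine mul_le_mul_of_nonneg_left ?_ (hnn x)
        have hmn' : (m : ℝ) ≤ n := by exact_mod_cast hmn
        rcases Nat.eq_zero_or_pos m with rfl | hm0
        · simp
          positivity
        have hm0 : (0 : ℝ) < m := by exact_mod_cast hm0
        rw [div_le_div_iff₀ (by positivity) (by nlinarith [sq_nonneg x])]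
        have : (m : ℝ) ^ 2 ≤ (n : ℝ) ^ 2 := by gcongr
        nlinarith [sq_nonneg x]
      · refine Eventually.of_forall fun x => (ENNReal.continuous_ofReal.tendsto _).comp ?_
        have h2 : Tendsto (fun n : ℕ => x ^ 2 / (n : ℝ) ^ 2) atTop (𝓝 0) :=
          tendsto_const_nhds.div_atTop
            ((tendsto_pow_atTop two_ne_zero).comp tendsto_natCast_atTop_atTop)
        have h3 := (h2.const_add 1).inv₀ (by simp)
        have h4 := h3.const_mul (h x)
        simp only [add_zero, inv_one, mul_one] at h4
        refine h4.congr' ?_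
        filter_upwards [eventually_gt_atTop 0] with n hn0
        have hn0 : (0 : ℝ) < n := by exact_mod_cast hn0
        field_simp
    have hlim2 : Tendsto (fun n : ℕ => ENNReal.ofReal (-(n * (Φ (n * I + ε * I)).im))) atTop
        (𝓝 1) := by
      rw [← ENNReal.ofReal_one]
      refine (ENNReal.continuous_ofReal.tendsto _).comp ?_
      have hz : Tendsto (fun n : ℕ => ((n : ℂ) * I + ε * I)) atTop
          (Bornology.cobounded ℂ ⊓ 𝓟 {z | ε ≤ z.im}) := by
        refine tendsto_inf.2 ⟨?_, tendsto_principal.2 (Eventually.of_forall fun n => by simp)⟩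
        rw [← comap_norm_atTop, tendsto_comap_iff]
        refine tendsto_atTop_mono (fun n => ?_) tendsto_natCast_atTop_atTop
        have := Complex.abs_im_le_norm ((n : ℂ) * I + ε * I)
        simp only [Complex.add_im, Complex.mul_im, Complex.natCast_re, Complex.I_im, mul_one,
          Complex.natCast_im, Complex.I_re, mul_zero, add_zero, Complex.ofReal_re,
          Complex.ofReal_im] at this
        exact (by linarith [le_abs_self ((n : ℝ) + ε)] : (n : ℝ) ≤ _)
      have h2 := (Complex.continuous_re.tendsto _).comp (h1.comp hz)
      have h3 : Tendsto (fun n : ℕ => (n : ℝ) / (n + ε)) atTop (𝓝 1) :=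
        tendsto_natCast_div_add_atTop ε
      have h4 := h2.mul h3
      simp only [Complex.one_re, mul_one] at h4
      refine h4.congr fun n => ?_
      have : (n : ℝ) + ε ≠ 0 := by positivity
      simp
      field_simp
    rw [hν, withDensity_apply _ MeasurableSet.univ, Measure.restrict_univ]
    refine tendsto_nhds_unique hlim ?_
    simp_rw [hn]
    exact hlim2
  refine ⟨⟨ν, ⟨hmass⟩⟩, fun w hw => ?_⟩
  rw [← (hrep w hw).2]
  change ∫ x : ℝ, (w - (x : ℂ))⁻¹ ∂ν = _
  rw [hν, integral_withDensity_eq_integral_toReal_smul hcont.measurable.ennreal_ofReal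
    (Eventually.of_forall fun x => ENNReal.ofReal_lt_top)]
  refine integral_congr_ae (Eventually.of_forall fun x => ?_)
  simp only [ENNReal.toReal_ofReal (hnn x), Complex.real_smul]
  rfl

/-- The tails of `ν` are controlled by the deviation of `i y G_ν(i y)` from `1`, since
`1 + y Im G_ν(i y) = ∫ x² / (x² + y²) ν(dx)` and the integrand is at least `1 / 2` for `|x| > y`. -/
theorem measure_compl_closedBall_le (ν : ProbabilityMeasure ℝ) {y : ℝ} (hy : 0 < y) :
    (ν : Measure ℝ) (Metric.closedBall 0 y)ᶜ ≤
      ENNReal.ofReal (2 * (1 + y * (cauchyTransform (ν : Measure ℝ) (y * I)).im)) := by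
  have hz : 0 < ((y : ℂ) * I).im := by simpa using hy
  have h := ae_im_le_norm_sub (ν : Measure ℝ) hz
  have hI := (integrable_inv_normSq_sub hz h).const_mul (y ^ 2)
  have heq : 2 * (1 + y * (cauchyTransform (ν : Measure ℝ) (y * I)).im) =
      ∫ x : ℝ, 2 * (1 - y ^ 2 * (Complex.normSq (y * I - x))⁻¹) ∂(ν : Measure ℝ) := by
    rw [cauchyTransform_im hz h, integral_const_mul, integral_sub (integrable_const _) hI,
      integral_const_mul]
    simp
    ring
  have hns : ∀ x : ℝ, Complex.normSq (y * I - x) = x ^ 2 + y ^ 2 := fun x => by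
    simp [Complex.normSq_apply]; ring
  rw [heq, ← ofReal_measureReal,
    ← integral_indicator_one Metric.isClosed_closedBall.measurableSet.compl]
  refine ENNReal.ofReal_le_ofReal (integral_mono ?_ (((integrable_const _).sub hI).const_mul _)
    fun x => ?_)
  · exact (integrable_const (1 : ℝ)).indicator Metric.isClosed_closedBall.measurableSet.compl
  · rw [hns]
    by_cases hx : x ∈ (Metric.closedBall (0 : ℝ) y)ᶜ
    · rw [indicator_of_mem hx]
      have h1 : y < |x| := by simpa using hx
      have h2 : y ^ 2 ≤ x ^ 2 := by rw [← sq_abs x]; gcongr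
      have h3 : y ^ 2 * (x ^ 2 + y ^ 2)⁻¹ ≤ 1 / 2 := by
        rw [← div_eq_mul_inv, div_le_div_iff₀ (by positivity) two_pos]
        linarith
      simp only [Pi.one_apply]
      linarith
    · rw [indicator_of_notMem hx]
      have h3 : y ^ 2 * (x ^ 2 + y ^ 2)⁻¹ ≤ 1 := by
        rw [← div_eq_mul_inv, div_le_one (by positivity)]
        nlinarith [sq_nonneg x]
      linarith

/-- Nevanlinna's characterization of Cauchy transforms of probability measures: the shifted
functions are Cauchy transforms by the half-plane Cauchy formula, the behaviour at infinity makes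
the corresponding measures tight, and any limit point has Cauchy transform `Φ`. -/
theorem exists_cauchyTransform_eq (hΦ : DifferentiableOn ℂ Φ {z | 0 < z.im})
    (him : ∀ z : ℂ, 0 < z.im → (Φ z).im ≤ 0)
    (h1 : ∀ ε : ℝ, 0 < ε →
      Tendsto (fun z => z * Φ z) (Bornology.cobounded ℂ ⊓ 𝓟 {z | ε ≤ z.im}) (𝓝 1)) :
    ∃ ν : ProbabilityMeasure ℝ, ∀ w : ℂ, 0 < w.im →
      cauchyTransform (ν : Measure ℝ) w = Φ w := by
  have hpos : ∀ n : ℕ, (0 : ℝ) < 1 / ((n : ℝ) + 1) := fun n => Nat.one_div_pos_of_nat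
  choose ν hν using fun n : ℕ => exists_cauchyTransform_eq_shift (hpos n) hΦ him (h1 _ (hpos n))
  have htight : IsTightMeasureSet
      {((μ : ProbabilityMeasure ℝ) : Measure ℝ) | μ ∈ range ν} := by
    rw [isTightMeasureSet_iff_exists_isCompact_measure_compl_le]
    intro η hη
    obtain ⟨δ, hδ0, hδ1, hδ⟩ : ∃ δ : ℝ, 0 < δ ∧ δ ≤ 1 ∧ ENNReal.ofReal δ ≤ η := by
      rcases eq_or_ne η ⊤ with rfl | hη'
      · exact ⟨1, one_pos, le_rfl, le_top⟩
      · exact ⟨min 1 η.toReal, lt_min one_pos (ENNReal.toReal_pos hη.ne' hη'), min_le_left _ _,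
          (ENNReal.ofReal_le_ofReal (min_le_right _ _)).trans ENNReal.ofReal_toReal_le⟩
    obtain ⟨R, hR1, hR⟩ := exists_bound_of_tendsto (by positivity : 0 < δ / 4) (h1 1 one_pos)
    set y : ℝ := max R (8 / δ) with hy
    have hyR : R ≤ y := le_max_left _ _
    have hyδ : 8 / δ ≤ y := le_max_right _ _
    have hy1 : 1 ≤ y := hR1.trans hyR
    refine ⟨Metric.closedBall 0 y, isCompact_closedBall _ _, ?_⟩
    rintro _ ⟨_, ⟨n, rfl⟩, rfl⟩
    refine (measure_compl_closedBall_le (ν n) (by linarith)).trans (le_trans ?_ hδ)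
    refine ENNReal.ofReal_le_ofReal ?_
    rw [hν n _ (by simp; linarith)]
    set ε : ℝ := 1 / ((n : ℝ) + 1) with hε
    have hε0 : 0 < ε := hpos n
    have hε1 : ε ≤ 1 := by
      rw [hε, div_le_one (by positivity)]
      have : (0 : ℝ) ≤ n := Nat.cast_nonneg n
      linarith
    have hadd : (y : ℂ) * I + ε * I = ((y + ε : ℝ) : ℂ) * I := by push_cast; ring
    rw [hadd]
    have h2 := hR (((y + ε : ℝ) : ℂ) * I) (by simp; linarith) (by
      rw [norm_mul, Complex.norm_I, mul_one, Complex.norm_real, Real.norm_eq_abs]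
      linarith [le_abs_self (y + ε)])
    have h3 := (Complex.abs_re_le_norm _).trans h2
    have h4 := him (((y + ε : ℝ) : ℂ) * I) (by simp; linarith)
    set b : ℝ := (Φ (((y + ε : ℝ) : ℂ) * I)).im with hb
    have h5 : (((y + ε : ℝ) : ℂ) * I * Φ (((y + ε : ℝ) : ℂ) * I) - 1).re = -((y + ε) * b) - 1 := by
      rw [mul_assoc, Complex.sub_re, Complex.re_ofReal_mul, Complex.I_mul_re]
      simp [hb]
    rw [h5, abs_le] at h3
    -- `y b` is close to `(y + ε) b`, since `-b` is at most of the order `1 / y`.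
    have h6 : 8 ≤ y * δ := (div_le_iff₀ hδ0).1 hyδ
    have h7 : y * -b ≤ 5 / 4 := by nlinarith
    have h8 : 8 * -b ≤ 5 / 4 * δ := by nlinarith
    have h9 : ε * -b ≤ -b := by nlinarith
    nlinarith
  have hcomp := isCompact_closure_of_isTightMeasureSet htight
  -- A cluster point of the sequence, along an ultrafilter.
  obtain ⟨ν₀, -, hν₀⟩ := hcomp.ultrafilter_le_nhds ((hyperfilter ℕ).map ν)
    (by
      rw [le_principal_iff]
      exact mem_of_superset (range_mem_map) subset_closure)
  have hν₀ : Tendsto ν (hyperfilter ℕ : Filter ℕ) (𝓝 ν₀) := hν₀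
  refine ⟨ν₀, fun w hw => ?_⟩
  let fw : BoundedContinuousFunction ℝ ℂ :=
    BoundedContinuousFunction.ofNormedAddCommGroup (fun x : ℝ => (w - (x : ℂ))⁻¹)
      (Continuous.inv₀ (by fun_prop) fun x h => by
        have := congrArg Complex.im h
        simp at this
        linarith) w.im⁻¹ (fun x => by
        rw [norm_inv]
        have := (le_abs_self _).trans (im_le_norm_sub w x)
        gcongr)
  have hl := (ProbabilityMeasure.tendsto_iff_forall_integral_rclike_tendsto ℂ).1 hν₀ fw
  have hl2 : Tendsto (fun n => cauchyTransform (ν n : Measure ℝ) w) (hyperfilter ℕ : Filter ℕ)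
    (𝓝 (cauchyTransform (ν₀ : Measure ℝ) w)) := hl
  refine tendsto_nhds_unique hl2 ?_
  simp_rw [fun n => hν n w hw]
  have hc : ContinuousAt Φ w :=
    (hΦ.differentiableAt
      ((isOpen_lt continuous_const Complex.continuous_im).mem_nhds hw)).continuousAt
  refine Tendsto.mono_left ?_ (Nat.hyperfilter_le_atTop)
  refine hc.tendsto.comp ?_
  have h2 : Tendsto (fun n : ℕ => (((1 / ((n : ℝ) + 1) : ℝ) : ℂ))) atTop (𝓝 0) := by
    have := (Complex.continuous_ofReal.tendsto _).comp
      (tendsto_one_div_add_atTop_nhds_zero_nat (𝕜 := ℝ))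
    simpa [Function.comp_def] using this
  simpa using (h2.mul_const I).const_add w

end Nevanlinna

/-! ### Existence of the Boolean power and its Cauchy transform -/

section BooleanPower

open Complex (I)

theorem arg_mem_Ioc_of_im_nonpos {k : ℂ} (hk : k ∈ Complex.slitPlane) (him : k.im ≤ 0) :
    k.arg ∈ Ioc (-Real.pi) 0 := by
  refine ⟨Complex.neg_pi_lt_arg k, ?_⟩
  by_contra h
  have h1 : 0 ≤ k.im := Complex.arg_nonneg_iff.1 (not_le.1 h).le
  have h2 : k.im = 0 := le_antisymm him h1
  rw [Complex.mem_slitPlane_iff] at hk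
  have h3 : 0 < k.re := hk.resolve_right (by simpa using h2)
  exact h (Complex.arg_eq_zero_iff.2 ⟨h3.le, h2⟩).le

theorem cpow_im_nonpos {k : ℂ} (hk : k ∈ Complex.slitPlane) (him : k.im ≤ 0) {t : ℝ}
    (ht0 : 0 ≤ t) (ht1 : t ≤ 1) : (k ^ (t : ℂ)).im ≤ 0 := by
  have harg := arg_mem_Ioc_of_im_nonpos hk him
  rw [Complex.cpow_def_of_ne_zero (Complex.slitPlane_ne_zero hk), Complex.exp_im,
    mul_comm, Complex.im_mul_ofReal, Complex.log_im]
  have h1 : Real.sin (k.arg * t) ≤ 0 := by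
    refine Real.sin_nonpos_of_nonpos_of_neg_pi_le (by nlinarith [harg.2]) ?_
    nlinarith [harg.1, harg.2, Real.pi_pos]
  exact mul_nonpos_of_nonpos_of_nonneg h1 (Real.exp_pos _).le

variable {μ : Measure ℝ} [IsProbabilityMeasure μ]

theorem im_sub_selfEnergy_cpow_pos (hμ : μ (Iio 0) = 0) (hμ0 : μ (Ioi 0) ≠ 0) {t : ℝ}
    (ht0 : 0 ≤ t) (ht1 : t ≤ 1) {z : ℂ} (hz : 0 < z.im) :
    0 < (z - selfEnergy μ z ^ (t : ℂ)).im := by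
  have := cpow_im_nonpos (selfEnergy_mem_slitPlane hμ hμ0 (mem_cutPlane_of_im_pos hz))
    (selfEnergy_im_nonpos hz) ht0 ht1
  rw [Complex.sub_im]
  linarith

theorem differentiableOn_selfEnergy_cpow (hμ : μ (Iio 0) = 0) (hμ0 : μ (Ioi 0) ≠ 0) (t : ℝ) :
    DifferentiableOn ℂ (fun z => selfEnergy μ z ^ (t : ℂ)) cutPlane :=
  (differentiableOn_selfEnergy hμ).cpow (differentiableOn_const _)
    fun _ hz => selfEnergy_mem_slitPlane hμ hμ0 hz

/-- At infinity `K_μ` is at most quadratic, hence `K_μ ^ t = o(|z|)` for `t ≤ 1 / 4`. -/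
theorem tendsto_mul_inv_sub_selfEnergy_cpow (hμ : μ (Iio 0) = 0) (hμ0 : μ (Ioi 0) ≠ 0) {t : ℝ}
    (ht0 : 0 ≤ t) (ht1 : t ≤ 1 / 4) {ε : ℝ} (hε : 0 < ε) :
    Tendsto (fun z => z * (z - selfEnergy μ z ^ (t : ℂ))⁻¹)
      (Bornology.cobounded ℂ ⊓ 𝓟 {z | ε ≤ z.im}) (𝓝 1) := by
  obtain ⟨C, hC1, hC⟩ := exists_norm_selfEnergy_le μ hε
  have hzero : Tendsto (fun z => selfEnergy μ z ^ (t : ℂ) / z)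
      (Bornology.cobounded ℂ ⊓ 𝓟 {z | ε ≤ z.im}) (𝓝 0) := by
    have hlim : Tendsto (fun z : ℂ => (2 * C) ^ (1 / 4 : ℝ) * ‖z‖ ^ (-(1 / 2) : ℝ))
        (Bornology.cobounded ℂ ⊓ 𝓟 {z | ε ≤ z.im}) (𝓝 0) := by
      have := ((tendsto_rpow_neg_atTop (by norm_num : (0 : ℝ) < 1 / 2)).comp
        (tendsto_norm_cobounded_atTop (E := ℂ))).const_mul ((2 * C) ^ (1 / 4 : ℝ))
      rw [mul_zero] at this
      exact this.mono_left inf_le_left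
    refine squeeze_zero_norm' ?_ hlim
    rw [eventually_inf_principal]
    filter_upwards [tendsto_norm_cobounded_atTop.eventually (eventually_ge_atTop 1)] with z h1 hz
    have h0 : 0 < ‖z‖ := by linarith
    rw [norm_div, Complex.norm_cpow_real, div_le_iff₀ h0]
    have h2 : ‖z‖ ^ (-(1 / 2) : ℝ) * ‖z‖ = ‖z‖ ^ (1 / 2 : ℝ) := by
      rw [← Real.rpow_add_one h0.ne']; norm_num
    have h3 : (‖z‖ ^ 2) ^ (1 / 4 : ℝ) = ‖z‖ ^ (1 / 2 : ℝ) := by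
      rw [← Real.rpow_natCast, ← Real.rpow_mul h0.le]; norm_num
    have h4 : ‖selfEnergy μ z‖ ≤ 2 * C * ‖z‖ ^ 2 := by
      refine (hC z hz).trans ?_
      nlinarith [mul_nonneg (by linarith : (0 : ℝ) ≤ C) (by nlinarith : 0 ≤ ‖z‖ ^ 2 - 1)]
    rw [mul_assoc, h2, ← h3, ← Real.mul_rpow (by linarith) (by positivity)]
    calc ‖selfEnergy μ z‖ ^ t ≤ (2 * C * ‖z‖ ^ 2) ^ t := by gcongr
      _ ≤ (2 * C * ‖z‖ ^ 2) ^ (1 / 4 : ℝ) := by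
          refine Real.rpow_le_rpow_of_exponent_le ?_ ht1
          nlinarith
  have h1 := (hzero.const_sub 1).inv₀ (by simp)
  rw [sub_zero, inv_one] at h1
  refine h1.congr' ?_
  rw [eventuallyEq_iff_exists_mem]
  refine ⟨{z | ε ≤ z.im}, mem_inf_of_right (mem_principal_self _), fun z hz => ?_⟩
  have hz0 : z ≠ 0 := by
    rintro rfl
    exact absurd hz (by simpa using hε)
  have hne : z - selfEnergy μ z ^ (t : ℂ) ≠ 0 := fun h => by
    have := im_sub_selfEnergy_cpow_pos hμ hμ0 ht0 (by linarith) (hε.trans_le hz)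
    rw [h] at this
    simp at this
  simp only
  rw [show (1 : ℂ) - selfEnergy μ z ^ (t : ℂ) / z = (z - selfEnergy μ z ^ (t : ℂ)) / z by
    field_simp, inv_div, div_eq_mul_inv]

theorem selfEnergy_ofReal_im (μ : Measure ℝ) (x : ℝ) : (selfEnergy μ x).im = 0 := by
  have : cauchyTransform μ x = ((∫ s, (x - s)⁻¹ ∂μ : ℝ) : ℂ) := by
    rw [cauchyTransform, ← integral_complex_ofReal]
    simp
  rw [selfEnergy, fTransform, this, ← Complex.ofReal_inv, ← Complex.ofReal_sub, Complex.ofReal_im]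

theorem exists_selfEnergy_eq_ofReal (hμ : μ (Iio 0) = 0) (hμ0 : μ (Ioi 0) ≠ 0) {x : ℝ}
    (hx : x < 0) : ∃ k : ℝ, 0 < k ∧ selfEnergy μ x = k := by
  have h1 := selfEnergy_mem_slitPlane hμ hμ0 (z := x) (Or.inl (by simpa using hx))
  have h2 := selfEnergy_ofReal_im μ x
  rw [Complex.mem_slitPlane_iff] at h1
  exact ⟨(selfEnergy μ x).re, h1.resolve_right (by simpa using h2),
    Complex.ext (by simp) (by simp [h2])⟩

theorem tendsto_add_mul_I (x : ℂ) :
    Tendsto (fun y : ℝ => x + y * I) (𝓝[>] 0) (𝓝 x) := by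
  have : Continuous fun y : ℝ => x + y * I := by fun_prop
  simpa using (this.tendsto 0).mono_left nhdsWithin_le_nhds

/-- The function `1 / (z - K_μ(z) ^ t)` is the Cauchy transform of a probability measure; its
boundary values on `(-∞, 0)` are real, so this measure lives on `[0, ∞)`. -/
theorem exists_isMulBooleanPower (μ : ProbabilityMeasure ℝ) (hμ : (μ : Measure ℝ) (Iio 0) = 0)
    (hμ0 : (μ : Measure ℝ) (Ioi 0) ≠ 0) {t : ℝ} (ht0 : 0 ≤ t) (ht1 : t ≤ 1 / 4) :
    ∃ ν : ProbabilityMeasure ℝ, IsMulBooleanPower μ t ν := by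
  set Φ : ℂ → ℂ := fun z => (z - selfEnergy (μ : Measure ℝ) z ^ (t : ℂ))⁻¹ with hΦ
  have hpos := fun (z : ℂ) (hz : 0 < z.im) =>
    im_sub_selfEnergy_cpow_pos hμ hμ0 ht0 (by linarith) hz
  have hKd := differentiableOn_selfEnergy_cpow hμ hμ0 t
  obtain ⟨ν, hν⟩ := exists_cauchyTransform_eq (Φ := Φ)
    ((differentiableOn_id.sub (hKd.mono fun z hz => mem_cutPlane_of_im_pos hz)).inv
      fun z hz h => by
        have := hpos z hz
        simp only [id_eq, Pi.sub_apply] at h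
        rw [h] at this
        simp at this)
    (fun z hz => by
      rw [hΦ, Complex.inv_im]
      exact div_nonpos_of_nonpos_of_nonneg (by linarith [hpos z hz]) (Complex.normSq_nonneg _))
    (fun ε hε => tendsto_mul_inv_sub_selfEnergy_cpow hμ hμ0 ht0 ht1 hε)
  have hreal : ∀ x : ℝ, x < 0 → ∃ d : ℝ, d < 0 ∧
      (x : ℂ) - selfEnergy (μ : Measure ℝ) x ^ (t : ℂ) = d := fun x hx => by
    obtain ⟨k, hk, hKk⟩ := exists_selfEnergy_eq_ofReal hμ hμ0 hx
    refine ⟨x - k ^ t, by have := Real.rpow_pos_of_pos hk t; linarith, ?_⟩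
    rw [hKk, ← Complex.ofReal_cpow hk.le, ← Complex.ofReal_sub]
  have hlim : ∀ x ∈ Iio (0 : ℝ), Tendsto (fun y : ℝ => cauchyTransform (ν : Measure ℝ) (x + y * I))
      (𝓝[>] 0) (𝓝 (Φ x)) := fun x hx => by
    have hxc : (x : ℂ) ∈ cutPlane := Or.inl (by simpa using hx)
    obtain ⟨d, hd, hxd⟩ := hreal x hx
    have hc : ContinuousAt Φ x := by
      refine ContinuousAt.inv₀ (continuousAt_id.sub
        (hKd.differentiableAt (isOpen_cutPlane.mem_nhds hxc)).continuousAt) ?_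
      simp only [hxd]
      exact_mod_cast hd.ne
    refine (hc.tendsto.comp (tendsto_add_mul_I x)).congr' ?_
    filter_upwards [self_mem_nhdsWithin] with y hy
    exact (hν _ (by simpa using hy)).symm
  have hν0 : (ν : Measure ℝ) (Iio 0) = 0 := by
    have h1 := restrict_eq_withDensity_of_tendsto_cauchyTransform measurableSet_Iio hlim
    have h2 : (fun x : ℝ => ENNReal.ofReal (-(Φ x).im / Real.pi)) =ᵐ[volume.restrict (Iio 0)]
        0 := by
      filter_upwards [ae_restrict_mem measurableSet_Iio] with x hx
      obtain ⟨d, -, hxd⟩ := hreal x hx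
      have : (Φ x).im = 0 := by
        simp only [hΦ, hxd]
        rw [← Complex.ofReal_inv, Complex.ofReal_im]
      simp [this]
    rw [withDensity_congr_ae h2, withDensity_zero] at h1
    exact Measure.restrict_eq_zero.1 h1
  refine ⟨ν, hν0, fun z hz => ?_⟩
  have hz' : ((z : ℝ) : ℂ) ≠ 0 := by exact_mod_cast hz.ne
  have hx : z⁻¹ < 0 := inv_lt_zero.2 hz
  have hxc : ((z⁻¹ : ℝ) : ℂ) ∈ cutPlane := Or.inl (by simpa using hx)
  rw [etaTransform_div_eq_selfEnergy _ hz', etaTransform_div_eq_selfEnergy _ hz',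
    ← Complex.ofReal_inv]
  have hc := ((differentiableOn_cauchyTransform_cutPlane hν0).differentiableAt
    (isOpen_cutPlane.mem_nhds hxc)).continuousAt
  have heq := tendsto_nhds_unique (hc.tendsto.comp (tendsto_add_mul_I _)) (hlim _ hx)
  rw [selfEnergy, fTransform, heq, hΦ, inv_inv]
  ring

theorem isMulBooleanPower_mulBooleanPower (μ : ProbabilityMeasure ℝ)
    (hμ : (μ : Measure ℝ) (Iio 0) = 0) (hμ0 : (μ : Measure ℝ) (Ioi 0) ≠ 0) {t : ℝ} (ht0 : 0 ≤ t)
    (ht1 : t ≤ 1 / 4) : IsMulBooleanPower μ t (mulBooleanPower μ t) := by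
  have h := exists_isMulBooleanPower μ hμ hμ0 ht0 ht1
  have heq : mulBooleanPower μ t = h.choose := dif_pos h
  rw [heq]
  exact h.choose_spec

/-- The defining relation on `(-∞, 0)` extends to the upper half-plane by analytic continuation. -/
theorem IsMulBooleanPower.cauchyTransform_eq {μ ν : ProbabilityMeasure ℝ} {t : ℝ}
    (h : IsMulBooleanPower μ t ν) (hμ : (μ : Measure ℝ) (Iio 0) = 0)
    (hμ0 : (μ : Measure ℝ) (Ioi 0) ≠ 0) {z : ℂ} (hz : 0 < z.im) :
    cauchyTransform (ν : Measure ℝ) z = (z - selfEnergy (μ : Measure ℝ) z ^ (t : ℂ))⁻¹ := by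
  have hneg : ∀ x : ℝ, x < 0 →
      selfEnergy (ν : Measure ℝ) x = selfEnergy (μ : Measure ℝ) x ^ (t : ℂ) := fun x hx => by
    have hx' : ((x⁻¹ : ℝ) : ℂ) ≠ 0 := by exact_mod_cast (inv_lt_zero.2 hx).ne
    have h1 := h.2 x⁻¹ (inv_lt_zero.2 hx)
    rwa [etaTransform_div_eq_selfEnergy _ hx', etaTransform_div_eq_selfEnergy _ hx',
      ← Complex.ofReal_inv, inv_inv] at h1
  have hfreq : ∃ᶠ w in 𝓝[≠] ((-1 : ℝ) : ℂ),
      selfEnergy (ν : Measure ℝ) w = selfEnergy (μ : Measure ℝ) w ^ (t : ℂ) := by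
    have ht : Tendsto (fun x : ℝ => (x : ℂ)) (𝓝[≠] (-1)) (𝓝[≠] ((-1 : ℝ) : ℂ)) :=
      tendsto_nhdsWithin_of_tendsto_nhds_of_eventually_within _
        ((Complex.continuous_ofReal.tendsto _).mono_left nhdsWithin_le_nhds) (by
          filter_upwards [self_mem_nhdsWithin] with x hx
          exact Complex.ofReal_injective.ne hx)
    refine ht.frequently (Eventually.frequently ?_)
    filter_upwards [nhdsWithin_le_nhds (Iio_mem_nhds (by norm_num : (-1 : ℝ) < 0))] with x hx
    exact hneg x hx
  have heq : EqOn (selfEnergy (ν : Measure ℝ))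
      (fun w => selfEnergy (μ : Measure ℝ) w ^ (t : ℂ)) cutPlane :=
    ((differentiableOn_selfEnergy h.1).analyticOnNhd
      isOpen_cutPlane).eqOn_of_preconnected_of_frequently_eq
      ((differentiableOn_selfEnergy_cpow hμ hμ0 t).analyticOnNhd isOpen_cutPlane)
      isPreconnected_cutPlane (Or.inl (by simp)) hfreq
  have hz' : selfEnergy (ν : Measure ℝ) z = selfEnergy (μ : Measure ℝ) z ^ (t : ℂ) :=
    heq (mem_cutPlane_of_im_pos hz)
  rw [← hz', selfEnergy, fTransform, sub_sub_cancel, inv_inv]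

end BooleanPower

/-! ### The logarithm on the closed lower half-plane -/

section LowerLog

open Complex (I)

/-- The branch of the logarithm that is continuous on the closed lower half-plane without `0`; on
`(-∞, 0)` it takes the value `log (k - i0)`. -/
def lowerLog (k : ℂ) : ℂ := Complex.log (I * k) - (Real.pi / 2 : ℝ) * I

variable {k : ℂ}

theorem I_mul_mem_slitPlane (him : k.im ≤ 0) (hk : k ≠ 0) : I * k ∈ Complex.slitPlane := by
  rw [Complex.mem_slitPlane_iff, Complex.I_mul_re, Complex.I_mul_im]
  by_cases h : k.im = 0
  · exact Or.inr fun hre => hk (Complex.ext hre h)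
  · exact Or.inl (neg_pos.2 (lt_of_le_of_ne him h))

theorem continuousAt_lowerLog (him : k.im ≤ 0) (hk : k ≠ 0) : ContinuousAt lowerLog k :=
  (((continuous_const.mul continuous_id).continuousAt).clog
    (I_mul_mem_slitPlane him hk)).sub continuousAt_const

theorem lowerLog_eq_log (hk : k ∈ Complex.slitPlane) (him : k.im ≤ 0) :
    lowerLog k = Complex.log k := by
  have harg := arg_mem_Ioc_of_im_nonpos hk him
  rw [lowerLog, Complex.log_mul Complex.I_ne_zero (Complex.slitPlane_ne_zero hk), Complex.log_I]
  · push_cast; ring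
  · rw [Complex.arg_I]
    constructor <;> linarith [harg.1, harg.2, Real.pi_pos]

theorem lowerLog_im_mem_Icc (him : k.im ≤ 0) : (lowerLog k).im ∈ Icc (-Real.pi) 0 := by
  have h1 : |(I * k).arg| ≤ Real.pi / 2 := by
    rw [Complex.abs_arg_le_pi_div_two_iff, Complex.I_mul_re]
    linarith
  have h2 : (lowerLog k).im = (I * k).arg - Real.pi / 2 := by
    rw [lowerLog, Complex.sub_im, Complex.log_im, Complex.im_ofReal_mul, Complex.I_im, mul_one]
  rw [abs_le] at h1
  rw [h2]
  constructor <;> linarith [h1.1, h1.2]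

theorem lowerLog_im_neg (hk : k.im < 0 ∨ k.im = 0 ∧ k.re < 0) : (lowerLog k).im < 0 := by
  have him : k.im ≤ 0 := hk.elim le_of_lt fun h => h.1.le
  refine lt_of_le_of_ne (lowerLog_im_mem_Icc him).2 fun h => ?_
  rw [lowerLog, Complex.sub_im, Complex.log_im, Complex.im_ofReal_mul, Complex.I_im, mul_one,
    sub_eq_zero, Complex.arg_eq_pi_div_two_iff, Complex.I_mul_re, Complex.I_mul_im] at h
  rcases hk with hk | hk <;> linarith [h.1, h.2]

theorem tendsto_log_sub_mul_I (him : k.im ≤ 0) (hk : k ≠ 0) :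
    Tendsto (fun ε : ℝ => Complex.log (k - ε * I)) (𝓝[>] 0) (𝓝 (lowerLog k)) := by
  have h1 : Tendsto (fun ε : ℝ => k - ε * I) (𝓝[>] 0) (𝓝 k) := by
    have : Continuous fun ε : ℝ => k - ε * I := by fun_prop
    simpa using (this.tendsto 0).mono_left nhdsWithin_le_nhds
  refine ((continuousAt_lowerLog him hk).tendsto.comp h1).congr' ?_
  filter_upwards [self_mem_nhdsWithin] with ε (hε : 0 < ε)
  have h2 : (k - ε * I).im < 0 := by simp; linarith
  exact lowerLog_eq_log (Complex.mem_slitPlane_iff.2 (Or.inr h2.ne)) h2.le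

theorem exp_ofReal_mul_im_neg {a : ℂ} (ha : a.im ∈ Ico (-Real.pi) 0) {t : ℝ} (ht0 : 0 < t)
    (ht1 : t < 1) : (Complex.exp (t * a)).im < 0 := by
  rw [Complex.exp_im, Complex.im_ofReal_mul]
  refine mul_neg_of_pos_of_neg (Real.exp_pos _) (Real.sin_neg_of_neg_of_neg_pi_lt ?_ ?_)
  · nlinarith [ha.2]
  · nlinarith [ha.1, ha.2]

theorem tendsto_exp_mul_sub_one_div {ι : Type*} {l : Filter ι} {t a : ι → ℂ} {a₀ : ℂ}
    (ht : Tendsto t l (𝓝 0)) (ht0 : ∀ᶠ i in l, t i ≠ 0) (ha : Tendsto a l (𝓝 a₀)) :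
    Tendsto (fun i => (Complex.exp (t i * a i) - 1) / t i) l (𝓝 a₀) := by
  have hc : ContinuousAt (dslope Complex.exp 0) 0 :=
    continuousAt_dslope_same.2 Complex.differentiableAt_exp
  have h1 : Tendsto (fun i => t i * a i) l (𝓝 0) := by simpa using ht.mul ha
  have h2 := ha.mul (hc.tendsto.comp h1)
  rw [dslope_same, Complex.deriv_exp, Complex.exp_zero, mul_one] at h2
  refine h2.congr' ?_
  filter_upwards [ht0] with i hi
  have h3 := sub_smul_dslope Complex.exp 0 (t i * a i)
  rw [sub_zero, Complex.exp_zero, smul_eq_mul] at h3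
  rw [← h3, Function.comp_apply]
  field_simp

end LowerLog

/-! ### Boundary values of the Cauchy transform of the Boolean power -/

section Boundary

open Complex (I)

/-- The boundary value `K_μ(x + i0) = x - F_μ(x + i0)` of the self-energy. -/
def selfEnergyBoundary (μ : Measure ℝ) (x : ℝ) : ℂ := x - fBoundary μ x

theorem tendsto_fBoundary {μ : Measure ℝ} {x : ℝ}
    (h : ∃ w : ℂ, 0 ≤ w.im ∧
      Tendsto (fun y : ℝ => fTransform μ ((x : ℂ) + (y : ℂ) * I)) (𝓝[>] 0) (𝓝 w)) :
    0 ≤ (fBoundary μ x).im ∧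
      Tendsto (fun y : ℝ => fTransform μ ((x : ℂ) + (y : ℂ) * I)) (𝓝[>] 0)
        (𝓝 (fBoundary μ x)) := by
  obtain ⟨w, hw, hlim⟩ := h
  have : fBoundary μ x = w := hlim.limUnder_eq
  rw [this]
  exact ⟨hw, hlim⟩

/-- The only measure on `[0, ∞)` without mass on `(0, ∞)` is `δ₀`, for which `F(z) = z`. -/
theorem measure_Ioi_ne_zero_of_fBoundary_one_ne_one {μ : Measure ℝ} [IsProbabilityMeasure μ]
    (hμ : μ (Iio 0) = 0) (h1 : fBoundary μ 1 ≠ 1) : μ (Ioi 0) ≠ 0 := by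
  intro h0
  have hae : ∀ᵐ x ∂μ, x = 0 := by
    have : ∀ᵐ x ∂μ, x ∉ Ioi (0 : ℝ) := measure_eq_zero_iff_ae_notMem.1 h0
    filter_upwards [this, ae_nonneg_of_measure_Iio hμ] with x hx hx'
    exact le_antisymm (not_lt.1 hx) hx'
  have hF : ∀ z, fTransform μ z = z := fun z => by
    rw [fTransform, cauchyTransform, integral_congr_ae (g := fun _ => z⁻¹)]
    · simp
    · filter_upwards [hae] with x hx
      simp [hx]
  refine h1 (Tendsto.limUnder_eq ?_)
  simp_rw [hF]
  simpa using tendsto_add_mul_I 1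

/-- `G_ν(x + i0) = 1 / (x - exp (t log K_μ(x + i0)))` for the Boolean power `ν` with exponent
`t`. -/
theorem IsMulBooleanPower.tendsto_cauchyTransform {μ ν : ProbabilityMeasure ℝ} {t : ℝ}
    (h : IsMulBooleanPower μ t ν) (hμ : (μ : Measure ℝ) (Iio 0) = 0)
    (hμ0 : (μ : Measure ℝ) (Ioi 0) ≠ 0) (ht0 : 0 < t) (ht1 : t < 1) {x : ℝ}
    (hF0 : 0 ≤ (fBoundary (μ : Measure ℝ) x).im)
    (hF : Tendsto (fun y : ℝ => fTransform (μ : Measure ℝ) ((x : ℂ) + (y : ℂ) * I)) (𝓝[>] 0)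
      (𝓝 (fBoundary (μ : Measure ℝ) x)))
    (hne : selfEnergyBoundary (μ : Measure ℝ) x ≠ 0)
    (hneg : (lowerLog (selfEnergyBoundary (μ : Measure ℝ) x)).im < 0) :
    Tendsto (fun y : ℝ => cauchyTransform (ν : Measure ℝ) (x + y * I)) (𝓝[>] 0)
      (𝓝 (x - Complex.exp (t * lowerLog (selfEnergyBoundary (μ : Measure ℝ) x)))⁻¹) := by
  set κ := selfEnergyBoundary (μ : Measure ℝ) x with hκ
  have him : κ.im ≤ 0 := by
    rw [hκ, selfEnergyBoundary, Complex.sub_im, Complex.ofReal_im]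
    linarith
  have hK : Tendsto (fun y : ℝ => selfEnergy (μ : Measure ℝ) (x + y * I)) (𝓝[>] 0) (𝓝 κ) :=
    (tendsto_add_mul_I x).sub hF
  have hL := (continuousAt_lowerLog him hne).tendsto.comp hK
  have hE := (Complex.continuous_exp.tendsto _).comp (hL.const_mul (t : ℂ))
  have hden : (x : ℂ) - Complex.exp (t * lowerLog κ) ≠ 0 := fun h0 => by
    have h1 := exp_ofReal_mul_im_neg ⟨(lowerLog_im_mem_Icc him).1, hneg⟩ ht0 ht1
    have h2 := congrArg Complex.im h0
    rw [Complex.sub_im, Complex.ofReal_im, Complex.zero_im] at h2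
    linarith
  refine (((tendsto_add_mul_I x).sub hE).inv₀ hden).congr' ?_
  filter_upwards [self_mem_nhdsWithin] with y (hy : 0 < y)
  have hz : 0 < ((x : ℂ) + y * I).im := by simpa using hy
  have hs := selfEnergy_mem_slitPlane hμ hμ0 (mem_cutPlane_of_im_pos hz)
  rw [h.cauchyTransform_eq hμ hμ0 hz, Complex.cpow_def_of_ne_zero (Complex.slitPlane_ne_zero hs),
    ← lowerLog_eq_log hs (selfEnergy_im_nonpos hz), mul_comm _ (t : ℂ)]
  rfl

/-- The boundary values are measurable as pointwise limits of continuous functions. -/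
theorem measurable_indicator_im_of_tendsto {ν : Measure ℝ} [IsFiniteMeasure ν] {J : Set ℝ}
    (hJ : MeasurableSet J) {g : ℝ → ℂ}
    (h : ∀ x ∈ J, Tendsto (fun y : ℝ => cauchyTransform ν (x + y * I)) (𝓝[>] 0) (𝓝 (g x))) :
    Measurable (J.indicator fun x => -(g x).im / Real.pi) := by
  have hpos : ∀ n : ℕ, (0 : ℝ) < 1 / ((n : ℝ) + 1) := fun n => Nat.one_div_pos_of_nat
  have hlim : Tendsto (fun n : ℕ => 1 / ((n : ℝ) + 1)) atTop (𝓝[>] 0) :=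
    tendsto_nhdsWithin_iff.2 ⟨tendsto_one_div_add_atTop_nhds_zero_nat,
      Eventually.of_forall hpos⟩
  refine measurable_of_tendsto_metrizable (f := fun n : ℕ => J.indicator fun x : ℝ =>
    -(cauchyTransform ν (x + (1 / ((n : ℝ) + 1) : ℝ) * I)).im / Real.pi) (fun n => ?_) ?_
  · have hc := continuous_comp_horizontal (f := cauchyTransform ν) (ε := 1 / ((n : ℝ) + 1))
      ((differentiableOn_cauchyTransform_upper ν).mono fun z hz => (hpos n).trans_le hz)
    exact ((Complex.continuous_im.comp hc).neg.div_const _).measurable.indicator hJ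
  · refine tendsto_pi_nhds.2 fun x => ?_
    by_cases hx : x ∈ J
    · simp only [indicator_of_mem hx]
      exact (((Complex.continuous_im.tendsto _).comp ((h x hx).comp hlim)).neg).div_const _
    · simp only [indicator_of_notMem hx]
      exact tendsto_const_nhds

end Boundary

/-! ### Densities of power laws and of the log-Cauchy law -/

section Density

/-- Change of variables `x = s ^ t` in the density of `ν`, which is only needed on a set `J` that
contains all the points `s ^ t` with `s ∈ K`. -/
theorem hasDensityOn_powLaw {ν : ProbabilityMeasure ℝ} (hν : (ν : Measure ℝ) (Iio 0) = 0) {t : ℝ}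
    (ht : 0 < t) {J : Set ℝ} {D : ℝ → ℝ} (hD : Measurable D) (hD0 : ∀ x, 0 ≤ D x)
    (hdens : (ν : Measure ℝ).restrict J =
      (volume.restrict J).withDensity fun x => ENNReal.ofReal (D x))
    {K : Set ℝ} (hK : MeasurableSet K) (hK0 : K ⊆ Ioi 0) (hKJ : ∀ s ∈ K, s ^ t ∈ J) :
    HasDensityOn (powLaw ν (1 / t) : Measure ℝ)
      (fun s => (t * s ^ (t - 1)) * D (s ^ t)) K := by
  refine ⟨by fun_prop, fun s hs => ?_, ?_⟩
  · have : 0 < s := hK0 hs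
    have := hD0 (s ^ t)
    positivity
  · ext A hA
    have hB : MeasurableSet (A ∩ K) := hA.inter hK
    set B := A ∩ K with hBdef
    have hB0 : ∀ s ∈ B, 0 < s := fun s hs => hK0 hs.2
    -- For `x < 0` the value `x ^ (1 / t)` is junk and may lie in `B`; `ν` has no mass there.
    have himg : (fun s : ℝ => s ^ t) '' B = (fun x : ℝ => x ^ (1 / t)) ⁻¹' B ∩ Ici 0 := by
      ext x
      simp only [mem_image, mem_inter_iff, mem_preimage, mem_Ici]
      constructor
      · rintro ⟨s, hs, rfl⟩
        have hs0 := hB0 s hs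
        refine ⟨?_, by positivity⟩
        rwa [← Real.rpow_mul hs0.le, mul_one_div_cancel ht.ne', Real.rpow_one]
      · rintro ⟨hx, hx0⟩
        refine ⟨_, hx, ?_⟩
        rw [← Real.rpow_mul hx0, one_div_mul_cancel ht.ne', Real.rpow_one]
    have hmp : Measurable fun x : ℝ => x ^ (1 / t) := by fun_prop
    have himgm : MeasurableSet ((fun s : ℝ => s ^ t) '' B) := by
      rw [himg]
      exact (hmp hB).inter measurableSet_Ici
    have himgJ : (fun s : ℝ => s ^ t) '' B ⊆ J := by
      rintro _ ⟨s, hs, rfl⟩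
      exact hKJ s hs.2
    have h1 : (powLaw ν (1 / t) : Measure ℝ) B = (ν : Measure ℝ) ((fun s : ℝ => s ^ t) '' B) := by
      have : (powLaw ν (1 / t) : Measure ℝ) =
          (ν : Measure ℝ).map (fun x : ℝ => x ^ (1 / t)) := rfl
      rw [this, Measure.map_apply hmp hB, himg]
      refine (measure_inter_conull ?_).symm
      rw [compl_Ici]
      exact hν
    have hderiv : ∀ s ∈ B, HasDerivWithinAt (fun s : ℝ => s ^ t) (t * s ^ (t - 1)) B s :=
      fun s hs => (Real.hasDerivAt_rpow_const (Or.inl (hB0 s hs).ne')).hasDerivWithinAt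
    have hinj : InjOn (fun s : ℝ => s ^ t) B := fun s hs s' hs' h =>
      Real.rpow_left_injOn ht.ne' (hB0 s hs).le (hB0 s' hs').le h
    rw [Measure.restrict_apply hA, ← hBdef, h1, withDensity_apply _ hA,
      Measure.restrict_restrict hA, ← hBdef, ← inter_eq_left.2 himgJ,
      ← Measure.restrict_apply himgm, hdens,
      withDensity_apply _ himgm, Measure.restrict_restrict himgm, inter_eq_left.2 himgJ,
      lintegral_image_eq_lintegral_abs_deriv_mul hB hderiv hinj]
    refine setLIntegral_congr_fun hB fun s hs => ?_
    have hs0 := hB0 s hs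
    have hp : 0 < t * s ^ (t - 1) := by positivity
    simp only [abs_of_pos hp]
    rw [← ENNReal.ofReal_mul hp.le]

theorem measure_eq_lintegral_of_hasDensityOn {ν : Measure ℝ} {f : ℝ → ℝ} {K A : Set ℝ}
    (h : HasDensityOn ν f K) (hA : MeasurableSet A) (hAK : A ⊆ K) :
    ν A = ∫⁻ x in A, ENNReal.ofReal (f x) := by
  rw [← inter_eq_left.2 hAK, ← Measure.restrict_apply hA, h.2.2, withDensity_apply _ hA,
    Measure.restrict_restrict hA]

theorem logCauchy_Iic (β : ℝ) (γ : ℝ≥0) : (logCauchy β γ : Measure ℝ) (Iic 0) = 0 := by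
  have : (logCauchy β γ : Measure ℝ) = (cauchyMeasure β γ).map Real.exp := rfl
  rw [this, Measure.map_apply Real.measurable_exp measurableSet_Iic]
  convert measure_empty (μ := cauchyMeasure β γ)
  ext x
  simp [Real.exp_pos]

theorem hasDensityOn_logCauchy (β : ℝ) {γ : ℝ≥0} (hγ : 0 < γ) {K : Set ℝ} (hK : MeasurableSet K)
    (hK0 : K ⊆ Ioi 0) :
    HasDensityOn (logCauchy β γ : Measure ℝ)
      (fun x : ℝ => (γ : ℝ) / (Real.pi * x * ((Real.log x - β) ^ 2 + (γ : ℝ) ^ 2))) K := by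
  have hγ' : (0 : ℝ) < γ := hγ
  refine ⟨by fun_prop, fun s hs => ?_, ?_⟩
  · have : 0 < s := hK0 hs
    positivity
  · ext A hA
    have hB : MeasurableSet (A ∩ K) := hA.inter hK
    rw [Measure.restrict_apply hA, withDensity_apply _ hA, Measure.restrict_restrict hA]
    set B := A ∩ K with hBdef
    have hP : MeasurableSet (Real.exp ⁻¹' B) := Real.measurable_exp hB
    have himg : Real.exp '' (Real.exp ⁻¹' B) = B := by
      rw [image_preimage_eq_inter_range, Real.range_exp, inter_eq_left]
      exact fun x hx => hK0 hx.2
    have : (logCauchy β γ : Measure ℝ) = (cauchyMeasure β γ).map Real.exp := rfl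
    rw [this, Measure.map_apply Real.measurable_exp hB, cauchyMeasure_of_scale_ne_zero β hγ.ne',
      withDensity_apply _ hP]
    conv_rhs => rw [← himg]
    rw [lintegral_image_eq_lintegral_abs_deriv_mul hP
      (fun x _ => (Real.hasDerivAt_exp x).hasDerivWithinAt) Real.exp_injective.injOn]
    refine setLIntegral_congr_fun hP fun x hx => ?_
    simp only [Real.abs_exp, Real.log_exp]
    rw [← ENNReal.ofReal_mul (Real.exp_pos _).le, cauchyPDF_def, cauchyPDFReal_def]
    congr 1
    field_simp

/-- Scheffé's argument on `(0, ∞)`: if the densities converge uniformly on compact subsets of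
`(0, ∞)` to the density of a probability measure carried by `(0, ∞)`, no mass can escape. -/
theorem tendsto_of_tendstoUniformlyOn_density {ι : Type*} {l : Filter ι} [l.IsCountablyGenerated]
    [l.NeBot] {ν : ι → ProbabilityMeasure ℝ} {ρ : ProbabilityMeasure ℝ} {f : ι → ℝ → ℝ} {F : ℝ → ℝ}
    (hρ0 : (ρ : Measure ℝ) (Iic 0) = 0)
    (hρ : ∀ K : Set ℝ, IsCompact K → K ⊆ Ioi 0 → HasDensityOn (ρ : Measure ℝ) F K)
    (hν : ∀ K : Set ℝ, IsCompact K → K ⊆ Ioi 0 →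
      (∀ᶠ i in l, HasDensityOn (ν i : Measure ℝ) (f i) K) ∧ TendstoUniformlyOn f F l K) :
    Tendsto ν l (𝓝 ρ) := by
  refine tendsto_of_forall_isOpen_le_liminf' fun G hG => ?_
  set K : ℕ → Set ℝ := fun n => Icc (1 / ((n : ℝ) + 1)) ((n : ℝ) + 1) with hKdef
  have hpos : ∀ n : ℕ, (0 : ℝ) < 1 / ((n : ℝ) + 1) := fun n => Nat.one_div_pos_of_nat
  have hKc : ∀ n, IsCompact (K n) := fun n => isCompact_Icc
  have hK0 : ∀ n, K n ⊆ Ioi 0 := fun n x hx => (hpos n).trans_le hx.1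
  have hmono : Monotone fun n => G ∩ K n := fun m n hmn => by
    have hmn' : (m : ℝ) ≤ n := by exact_mod_cast hmn
    refine inter_subset_inter_right _ (Icc_subset_Icc ?_ (by linarith))
    gcongr
  have hunion : G ∩ Ioi 0 = ⋃ n, G ∩ K n := by
    rw [← inter_iUnion]
    congr 1
    refine Subset.antisymm (fun x (hx : 0 < x) => ?_) (iUnion_subset hK0)
    obtain ⟨n, hn⟩ := exists_nat_ge (max x x⁻¹)
    refine mem_iUnion.2 ⟨n, ?_, ?_⟩
    · rw [one_div, inv_le_comm₀ (by positivity) hx]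
      linarith [le_max_right x x⁻¹]
    · linarith [le_max_left x x⁻¹]
  have hGρ : (ρ : Measure ℝ) G = ⨆ n, (ρ : Measure ℝ) (G ∩ K n) := by
    rw [← hmono.measure_iUnion, ← hunion]
    refine (measure_inter_conull ?_).symm
    rwa [compl_Ioi]
  rw [hGρ]
  refine iSup_le fun n => ?_
  obtain ⟨hdens, hunif⟩ := hν (K n) (hKc n) (hK0 n)
  have hA : MeasurableSet (G ∩ K n) := hG.measurableSet.inter measurableSet_Icc
  have hρK := hρ (K n) (hKc n) (hK0 n)
  have hlim : Tendsto (fun i => ∫⁻ x in G ∩ K n, ENNReal.ofReal (f i x)) l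
      (𝓝 (∫⁻ x in G ∩ K n, ENNReal.ofReal (F x))) := by
    refine tendsto_lintegral_filter_of_dominated_convergence
      (fun x => ENNReal.ofReal (F x) + ENNReal.ofReal 1) ?_ ?_ ?_ ?_
    · filter_upwards [hdens] with i hi using hi.1.ennreal_ofReal
    · filter_upwards [Metric.tendstoUniformlyOn_iff.1 hunif 1 one_pos] with i hi
      filter_upwards [ae_restrict_mem hA] with x hx
      have h1 := hi x hx.2
      rw [← ENNReal.ofReal_add (hρK.2.1 x hx.2) zero_le_one]
      refine ENNReal.ofReal_le_ofReal ?_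
      rw [Real.dist_eq, abs_lt] at h1
      linarith [h1.1]
    · rw [lintegral_add_right _ measurable_const,
        ← measure_eq_lintegral_of_hasDensityOn hρK hA inter_subset_right, setLIntegral_const]
      refine ENNReal.add_ne_top.2 ⟨measure_ne_top _ _, ENNReal.mul_ne_top ENNReal.ofReal_ne_top ?_⟩
      exact ((measure_mono inter_subset_right).trans_lt (hKc n).measure_lt_top).ne
    · filter_upwards [ae_restrict_mem hA] with x hx
      exact (ENNReal.continuous_ofReal.tendsto _).comp (hunif.tendsto_at hx.2)
  rw [measure_eq_lintegral_of_hasDensityOn hρK hA inter_subset_right, ← hlim.liminf_eq]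
  refine liminf_le_liminf ?_
  filter_upwards [hdens] with i hi
  rw [← measure_eq_lintegral_of_hasDensityOn hi hA inter_subset_right]
  exact measure_mono inter_subset_left

end Density

/-! ### The limit of the densities -/

section Limit

open Complex (I)

theorem tendsto_rpow_nhds_zero_prod {s₀ : ℝ} (hs₀ : 0 < s₀) :
    Tendsto (fun q : ℝ × ℝ => q.2 ^ q.1) (𝓝 0 ×ˢ 𝓝 s₀) (𝓝 1) := by
  have h : ContinuousAt (fun q : ℝ × ℝ => q.2 ^ q.1) (0, s₀) :=
    continuousAt_snd.rpow continuousAt_fst (Or.inl hs₀.ne')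
  simpa [ContinuousAt, nhds_prod_eq] using h

/-- With `x = s ^ t`, both `x` and `exp (t ℓ(x))` are `1 + O(t)`, and
`(x - exp (t ℓ(x))) / t → log s - ℓ(1)`, which produces the Cauchy density in `log s`. -/
theorem tendsto_powLaw_density {ℓ : ℝ → ℂ} (hℓ : ContinuousAt ℓ 1) (hneg : (ℓ 1).im < 0)
    {J : Set ℝ} (hJ : J ∈ 𝓝 1) {s₀ : ℝ} (hs₀ : 0 < s₀) :
    Tendsto (fun q : ℝ × ℝ => (q.1 * q.2 ^ (q.1 - 1)) * J.indicator
        (fun x => -((x - Complex.exp (q.1 * ℓ x))⁻¹).im / Real.pi) (q.2 ^ q.1))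
      (𝓝[>] 0 ×ˢ 𝓝 s₀)
      (𝓝 (-(ℓ 1).im / (Real.pi * s₀ * ((Real.log s₀ - (ℓ 1).re) ^ 2 + (-(ℓ 1).im) ^ 2)))) := by
  set l : Filter (ℝ × ℝ) := 𝓝[>] 0 ×ˢ 𝓝 s₀ with hl
  have hfst : Tendsto (fun q : ℝ × ℝ => q.1) l (𝓝 0) :=
    tendsto_fst.mono_right nhdsWithin_le_nhds
  have hsnd : Tendsto (fun q : ℝ × ℝ => q.2) l (𝓝 s₀) := tendsto_snd
  have hpos1 : ∀ᶠ q : ℝ × ℝ in l, 0 < q.1 :=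
    tendsto_fst.eventually (p := fun t : ℝ => 0 < t) self_mem_nhdsWithin
  have hpos2 : ∀ᶠ q : ℝ × ℝ in l, 0 < q.2 := hsnd.eventually (lt_mem_nhds hs₀)
  have hpow : Tendsto (fun q : ℝ × ℝ => q.2 ^ q.1) l (𝓝 1) :=
    (tendsto_rpow_nhds_zero_prod hs₀).mono_left (prod_mono nhdsWithin_le_nhds le_rfl)
  have hfstC : Tendsto (fun q : ℝ × ℝ => (q.1 : ℂ)) l (𝓝 0) := by
    simpa [Function.comp_def] using (Complex.continuous_ofReal.tendsto 0).comp hfst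
  have hne : ∀ᶠ q : ℝ × ℝ in l, (q.1 : ℂ) ≠ 0 := by
    filter_upwards [hpos1] with q hq
    exact_mod_cast hq.ne'
  have hlog : Tendsto (fun q : ℝ × ℝ => ((Real.log q.2 : ℝ) : ℂ)) l (𝓝 (Real.log s₀ : ℝ)) :=
    (Complex.continuous_ofReal.tendsto _).comp ((Real.continuousAt_log hs₀.ne').tendsto.comp hsnd)
  have h1 := tendsto_exp_mul_sub_one_div hfstC hne hlog
  have h2 := tendsto_exp_mul_sub_one_div hfstC hne (hℓ.tendsto.comp hpow)
  have him : ((Real.log s₀ : ℂ) - ℓ 1).im = -(ℓ 1).im := by simp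
  have hre : ((Real.log s₀ : ℂ) - ℓ 1).re = Real.log s₀ - (ℓ 1).re := by simp
  have hlim0 : (Real.log s₀ : ℂ) - ℓ 1 ≠ 0 := fun h => by
    rw [h, Complex.zero_im] at him
    linarith
  have h3 := (Complex.continuous_im.tendsto _).comp ((h1.sub h2).inv₀ hlim0)
  have hsm : Tendsto (fun q : ℝ × ℝ => q.2 ^ (q.1 - 1)) l (𝓝 (s₀ ^ (0 - 1 : ℝ))) :=
    hsnd.rpow (hfst.sub_const 1) (Or.inl hs₀.ne')
  have h4 := (hsm.mul (h3.neg.div_const Real.pi))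
  have hval : s₀ ^ (0 - 1 : ℝ) * (-(((Real.log s₀ : ℂ) - ℓ 1)⁻¹).im / Real.pi) =
      -(ℓ 1).im / (Real.pi * s₀ * ((Real.log s₀ - (ℓ 1).re) ^ 2 + (-(ℓ 1).im) ^ 2)) := by
    rw [zero_sub, Real.rpow_neg_one, Complex.inv_im, Complex.normSq_apply, hre, him]
    have : 0 < (Real.log s₀ - (ℓ 1).re) ^ 2 + (ℓ 1).im ^ 2 := by
      have := sq_pos_of_neg hneg
      positivity
    rw [show (Real.log s₀ - (ℓ 1).re) * (Real.log s₀ - (ℓ 1).re) + -(ℓ 1).im * -(ℓ 1).im =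
      (Real.log s₀ - (ℓ 1).re) ^ 2 + (ℓ 1).im ^ 2 by ring, neg_sq]
    field_simp
  rw [hval] at h4
  refine h4.congr' ?_
  filter_upwards [hpos1, hpos2, hpow.eventually hJ] with q hq1 hq2 hqJ
  have hq1' : (q.1 : ℂ) ≠ 0 := by exact_mod_cast hq1.ne'
  have hexp : Complex.exp (q.1 * (Real.log q.2 : ℝ)) = ((q.2 ^ q.1 : ℝ) : ℂ) := by
    rw [Real.rpow_def_of_pos hq2, mul_comm (Real.log q.2)]
    push_cast
    rfl
  rw [indicator_of_mem hqJ]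
  simp only [Function.comp_apply]
  rw [hexp, ← sub_div, sub_sub_sub_cancel_right, inv_div, div_eq_mul_inv (q.1 : ℂ),
    Complex.im_ofReal_mul]
  ring

/-- Joint convergence `f i s → F s₀` as `s → s₀` and `i` runs along `l`, at every point `s₀` of an
open set, gives uniform convergence on its compact subsets. -/
theorem tendstoUniformlyOn_of_forall_tendsto_prod {ι : Type*} {l : Filter ι} {f : ι → ℝ → ℝ}
    {F : ℝ → ℝ} {U K : Set ℝ} (hF : ContinuousOn F U)
    (h : ∀ s₀ ∈ U, Tendsto (fun q : ι × ℝ => f q.1 q.2) (l ×ˢ 𝓝 s₀) (𝓝 (F s₀)))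
    (hU : IsOpen U) (hK : IsCompact K) (hKU : K ⊆ U) : TendstoUniformlyOn f F l K := by
  rw [← tendstoLocallyUniformlyOn_iff_tendstoUniformlyOn_of_compact hK,
    tendstoLocallyUniformlyOn_iff_forall_tendsto]
  intro s hs
  have hs' := hKU hs
  have h1 : Tendsto (fun q : ι × ℝ => F q.2) (l ×ˢ 𝓝 s) (𝓝 (F s)) :=
    (hF.continuousAt (hU.mem_nhds hs')).tendsto.comp tendsto_snd
  have h2 := h1.prodMk_nhds (h s hs')
  exact (h2.mono_right (nhds_le_uniformity _)).mono_left (prod_mono le_rfl nhdsWithin_le_nhds)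

end Limit

end

theorem mainTheorem8 (μ : ProbabilityMeasure ℝ) (hμ : (μ : Measure ℝ) (Iio 0) = 0)
    (hF : FBoundaryNearOne (μ : Measure ℝ))
    (hF1 : 0 < (fBoundary (μ : Measure ℝ) 1).im ∨
      ((fBoundary (μ : Measure ℝ) 1).im = 0 ∧ 1 < (fBoundary (μ : Measure ℝ) 1).re)) :
    ∃ (β : ℝ) (γ : ℝ≥0), 0 < γ ∧ (γ : ℝ) ≤ Real.pi ∧
      -- `log (1 - F_μ(1) - i0) = β - i γ`
      Tendsto (fun ε : ℝ => Complex.log (1 - fBoundary (μ : Measure ℝ) 1 - (ε : ℂ) * Complex.I))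
        (𝓝[>] 0) (𝓝 ((β : ℂ) - ((γ : ℝ) : ℂ) * Complex.I)) ∧
      -- locally uniform convergence of the densities
      (∃ f : ℝ → ℝ → ℝ, ∀ K : Set ℝ, IsCompact K → K ⊆ Ioi 0 →
        (∀ᶠ t in 𝓝[>] (0 : ℝ),
          HasDensityOn (powLaw (mulBooleanPower μ t) (1 / t) : Measure ℝ) (f t) K) ∧
        TendstoUniformlyOn f
          (fun x : ℝ => (γ : ℝ) / (Real.pi * x * ((Real.log x - β) ^ 2 + (γ : ℝ) ^ 2)))
          (𝓝[>] 0) K) ∧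
      -- weak convergence
      Tendsto (fun t : ℝ => powLaw (mulBooleanPower μ t) (1 / t)) (𝓝[>] 0)
        (𝓝 (logCauchy β γ)) := by
  obtain ⟨I, hIo, -, -, h1I, hlimI, hcont⟩ := hF
  have hb := fun (x : ℝ) (hx : x ∈ I) => tendsto_fBoundary (hlimI x hx)
  have hμ0 : (μ : Measure ℝ) (Ioi 0) ≠ 0 :=
    measure_Ioi_ne_zero_of_fBoundary_one_ne_one hμ fun h => by
      rw [h] at hF1
      simp at hF1
  set κ : ℝ → ℂ := selfEnergyBoundary (μ : Measure ℝ) with hκ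
  have hκ1 : κ 1 = 1 - fBoundary (μ : Measure ℝ) 1 := by simp [hκ, selfEnergyBoundary]
  have hκim : ∀ x ∈ I, (κ x).im ≤ 0 := fun x hx => by
    simp only [hκ, selfEnergyBoundary, Complex.sub_im, Complex.ofReal_im]
    linarith [(hb x hx).1]
  have hκneg : (κ 1).im < 0 ∨ (κ 1).im = 0 ∧ (κ 1).re < 0 := by
    rw [hκ1, Complex.sub_im, Complex.sub_re, Complex.one_im, Complex.one_re]
    rcases hF1 with h | h
    · exact Or.inl (by linarith)
    · exact Or.inr ⟨by linarith [h.1], by linarith [h.2]⟩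
  have hκ0 : κ 1 ≠ 0 := fun h => by
    rw [h] at hκneg
    simp at hκneg
  have hκc : ContinuousAt κ 1 :=
    Complex.continuous_ofReal.continuousAt.sub (hcont.continuousAt (hIo.mem_nhds h1I))
  set ℓ : ℝ → ℂ := fun x => lowerLog (κ x) with hℓ
  have hℓc : ContinuousAt ℓ 1 :=
    ContinuousAt.comp (continuousAt_lowerLog (hκim 1 h1I) hκ0) hκc
  have hℓneg : (ℓ 1).im < 0 := lowerLog_im_neg hκneg
  have hℓIcc := lowerLog_im_mem_Icc (hκim 1 h1I)
  -- A neighbourhood of `1` on which the boundary values of the Boolean powers exist for small `t`.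
  obtain ⟨δ, hδ, hball⟩ : ∃ δ > 0, Metric.ball (1 : ℝ) δ ⊆
      {x | x ∈ I ∧ κ x ≠ 0 ∧ (ℓ x).im < 0} :=
    Metric.mem_nhds_iff.1 ((show ∀ᶠ x in 𝓝 (1 : ℝ), x ∈ I from hIo.mem_nhds h1I).and
      ((hκc.eventually_ne hκ0).and
        ((Complex.continuous_im.continuousAt.comp hℓc).eventually (gt_mem_nhds hℓneg))))
  set J := Metric.ball (1 : ℝ) δ with hJ
  set g : ℝ → ℝ → ℂ := fun t x => (x - Complex.exp (t * ℓ x))⁻¹ with hg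
  set D : ℝ → ℝ → ℝ := fun t => J.indicator fun x => -(g t x).im / Real.pi with hD
  set f : ℝ → ℝ → ℝ := fun t s => (t * s ^ (t - 1)) * D t (s ^ t) with hf
  set β : ℝ := (ℓ 1).re with hβ
  set γ : ℝ≥0 := (-(ℓ 1).im).toNNReal with hγ
  have hγc : (γ : ℝ) = -(ℓ 1).im := Real.coe_toNNReal _ (by linarith)
  have hγ0 : 0 < γ := by
    rw [← NNReal.coe_pos, hγc]
    linarith
  set F : ℝ → ℝ := fun x => (γ : ℝ) / (Real.pi * x * ((Real.log x - β) ^ 2 + (γ : ℝ) ^ 2))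
  have hDnn : ∀ t : ℝ, 0 < t → t < 1 → ∀ x, 0 ≤ D t x := fun t ht0 ht1 =>
    indicator_nonneg fun x hx => by
      obtain ⟨hxI, -, hxneg⟩ := hball hx
      have h1 := exp_ofReal_mul_im_neg ⟨(lowerLog_im_mem_Icc (hκim x hxI)).1, hxneg⟩ ht0 ht1
      refine div_nonneg ?_ Real.pi_pos.le
      simp only [hg, Complex.inv_im, Complex.sub_im, Complex.ofReal_im, zero_sub, neg_neg]
      exact neg_nonneg.2 (div_nonpos_of_nonpos_of_nonneg h1.le (Complex.normSq_nonneg _))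
  have hdens : ∀ K : Set ℝ, IsCompact K → K ⊆ Ioi 0 → ∀ᶠ t in 𝓝[>] (0 : ℝ),
      HasDensityOn (powLaw (mulBooleanPower μ t) (1 / t) : Measure ℝ) (f t) K := by
    intro K hK hK0
    have hKJ : ∀ᶠ t in 𝓝 (0 : ℝ), ∀ s ∈ K, s ^ t ∈ J :=
      hK.eventually_forall_of_forall_eventually fun s hs => by
        rw [nhds_prod_eq]
        exact (tendsto_rpow_nhds_zero_prod (hK0 hs)).eventually (Metric.ball_mem_nhds 1 hδ)
    filter_upwards [Ioo_mem_nhdsGT (by norm_num : (0 : ℝ) < 1 / 4), nhdsWithin_le_nhds hKJ]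
      with t ht htK
    have ht1 : t < 1 := by linarith [ht.2]
    have hpow := isMulBooleanPower_mulBooleanPower μ hμ hμ0 ht.1.le ht.2.le
    have hlim : ∀ x ∈ J, Tendsto (fun y : ℝ =>
        cauchyTransform (mulBooleanPower μ t : Measure ℝ) (x + y * Complex.I)) (𝓝[>] 0)
        (𝓝 (g t x)) := fun x hx => by
      obtain ⟨hxI, hx0, hxneg⟩ := hball hx
      exact hpow.tendsto_cauchyTransform hμ hμ0 ht.1 ht1 (hb x hxI).1 (hb x hxI).2 hx0 hxneg
    refine hasDensityOn_powLaw hpow.1 ht.1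
      (measurable_indicator_im_of_tendsto Metric.isOpen_ball.measurableSet hlim)
      (hDnn t ht.1 ht1) ?_ hK.measurableSet hK0 htK
    rw [restrict_eq_withDensity_of_tendsto_cauchyTransform Metric.isOpen_ball.measurableSet hlim]
    refine withDensity_congr_ae ?_
    filter_upwards [ae_restrict_mem Metric.isOpen_ball.measurableSet] with x hx
    simp only [indicator_of_mem hx]
  have hFc : ContinuousOn F (Ioi 0) := by
    have hγ' : (0 : ℝ) < γ := hγ0
    refine continuousOn_const.div ((continuousOn_const.mul continuousOn_id).mul
      (((Real.continuousOn_log.mono fun x hx => ne_of_gt hx).sub continuousOn_const).pow 2 |>.add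
        continuousOn_const)) fun x hx => ?_
    have hx0 : (0 : ℝ) < x := hx
    have := Real.pi_pos
    positivity
  have hunif : ∀ K : Set ℝ, IsCompact K → K ⊆ Ioi 0 → TendstoUniformlyOn f F (𝓝[>] 0) K :=
    fun K hK hK0 => tendstoUniformlyOn_of_forall_tendsto_prod hFc
      (fun s₀ hs₀ => by
        have h := tendsto_powLaw_density hℓc hℓneg (Metric.ball_mem_nhds 1 hδ) hs₀
        rw [← hγc] at h
        exact h)
      isOpen_Ioi hK hK0
  refine ⟨β, γ, hγ0, by rw [hγc]; linarith [hℓIcc.1], ?_,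
    ⟨f, fun K hK hK0 => ⟨hdens K hK hK0, hunif K hK hK0⟩⟩, ?_⟩
  · have h1 := tendsto_log_sub_mul_I (hκim 1 h1I) hκ0
    rw [hκ1] at h1
    convert h1 using 2
    rw [← hκ1]
    apply Complex.ext <;> simp [hβ, hγc, hℓ]
  · exact tendsto_of_tendstoUniformlyOn_density (logCauchy_Iic β γ)
      (fun K hK hK0 => hasDensityOn_logCauchy β hγ0 hK.measurableSet hK0)
      fun K hK hK0 => ⟨hdens K hK hK0, hunif K hK hK0⟩
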